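/- Let $d\ge 2$. Let $M_n=M_n(\mathbb C)$, let $\mathbb M^d=\bigsqcup_{n\ge1}M_n^d$, and let $\mathbb M^d_{\rm sa}\subset\mathbb M^d$ be the set of tuples of selfadjoint matrices. A set $\mathcal S\subseteq\mathbb M^d$ is *matrix convex* if it is closed under direct sums and under entrywise application $X\mapsto(\phi(X_1),\dots,\phi(X_d))$ of unital completely positive (UCP) maps $\phi:M_n\to M_k$; its first level is $\mathcal S\cap M_1^d\subseteq\mathbb C^d$. Let $\overline{\mathbb B}_d$ be the closed Euclidean unit ball of $\mathbb R^d$, and let $\mathcal W^{\min}(\overline{\mathbb B}_d)$ and $\mathcal W^{\max}(\overline{\mathbb B}_d)$ be the smallest and the largest matrix convex set in $\mathbb M^d_{\rm sa}$ with first level $\overline{\mathbb B}_d$. Put $$\mathfrak B=\Bigl\{X\in\mathbb M^d_{\rm sa}:\sum_{i=1}^d X_i^2\le 1\Bigr\},\qquad \mathfrak D=\Bigl\{X\in\mathbb M^d_{\rm sa}:\sum_{i=1}^d X_i\otimes\overline{X_i}\le 1\Bigr\},$$ where $\overline{X_i}$ is the entrywise complex conjugate, and for $\mathcal S\subseteq\mathbb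 M^d_{\rm sa}$ let $$\mathcal S^\bullet=\Bigl\{X\in\mathbb M^d_{\rm sa}:\sum_{i=1}^d X_i\otimes Y_i\le I\text{ for all }Y\in\mathcal S\Bigr\}.$$ Let $s_i=\ell_i+\ell_i^*$ $(i=1,\dots,d)$ be the free semicircular tuple on the full Fock space $\mathcal F=\bigoplus_{n\ge0}(\mathbb C^d)^{\otimes n}$, where $\ell_i(x_1\otimes\cdots\otimes x_n)=e_i\otimes x_1\otimes\cdots\otimes x_n$ and $\ell_i\Omega=e_i$ are the free shifts. Let $$\mathcal W(s/2)=\bigsqcup_{n\ge1}\bigl\{(\phi(s_1/2),\dots,\phi(s_d/2)):\phi:B(\mathcal F)\to M_n\text{ UCP}\bigr\}$$ be the matrix range of $s/2$, and let $$\mathcal L=\Bigl\{X\in\mathbb M^d_{\rm sa}:\sum_{i=1}^d X_i\otimes \tfrac{s_i}{2}\le I\Bigr\}$$ be the Lehner ball. **Theorem.** For every $d\ge2$: 1. $\mathcal W^{\min}(\overline{\mathbb B}_d)\subseteq\mathfrak B$ and $\mathfrak B^\bullet\subseteq\mathcal W^{\max}(\overline{\mathbb B}_d)$; 2. $\mathfrak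 B\subsetneq\mathcal L\subsetneq\mathfrak B^\bullet$ and $\mathfrak B\subsetneq\mathcal W(s/2)\subsetneq\mathfrak B^\bullet$; 3. $\mathcal W(s/2)\not\subseteq\mathfrak D$ and $\mathfrak D\not\subseteq\mathcal L$. In particular, $\mathcal W(s/2)$ is different from each of the five sets $\mathcal W^{\min}(\overline{\mathbb B}_d)$, $\mathfrak B$, $\mathfrak D$, $\mathfrak B^\bullet$, $\mathcal W^{\max}(\overline{\mathbb B}_d)$. -/

import Mathlib

open scoped ComplexOrder CStarAlgebra

noncomputable section

namespace MatrixBall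

/-! ### The noncommutative universe -/

/-- The C⋆-algebra `M_n` of complex `n × n` matrices, with the operator norm and its usual
(Loewner) order `A ≤ B ↔ B - A` is positive. -/
abbrev Mat (n : ℕ) : Type := CStarMatrix (Fin n) (Fin n) ℂ

/-- The noncommutative universe `𝕄^d`: the disjoint union over `n ≥ 1` of the sets `M_n^d`. -/
abbrev Universe (d : ℕ) : Type := Σ n : ℕ+, (Fin d → Mat n)

/-- The selfadjoint noncommutative universe `𝕄^d_sa`. -/
def saUniverse (d : ℕ) : Set (Universe d) := {X | ∀ i, IsSelfAdjoint (X.2 i)}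

/-- The elementary tensor `x ⊗ a`, as an element of `M_n ⊗ 𝒜 = M_n(𝒜)`: the `n × n` matrix over
`𝒜` with entries `x k l • a`. -/
def tensor {𝒜 : Type*} [SMul ℂ 𝒜] {n : ℕ} (x : Mat n) (a : 𝒜) : CStarMatrix (Fin n) (Fin n) 𝒜 :=
  CStarMatrix.ofMatrix (Matrix.of fun k l => x k l • a)

/-! ### Matrix convex sets -/

/-- The direct sum (block diagonal matrix) of two matrices. -/
def directSum {n m : ℕ} (x : Mat n) (y : Mat m) : Mat (n + m) :=
  CStarMatrix.ofMatrix (Matrix.reindex finSumFinEquiv finSumFinEquiv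
    (Matrix.fromBlocks (CStarMatrix.ofMatrix.symm x) 0 0 (CStarMatrix.ofMatrix.symm y)))

/-- A subset of the universe is matrix convex if it is closed under direct sums and under
the application of unital completely positive maps `M_n → M_k`. -/
def IsMatrixConvex {d : ℕ} (S : Set (Universe d)) : Prop :=
  (∀ X ∈ S, ∀ Y ∈ S, (⟨X.1 + Y.1, fun i => directSum (X.2 i) (Y.2 i)⟩ : Universe d) ∈ S) ∧
  (∀ X ∈ S, ∀ (k : ℕ+) (φ : Mat X.1 →CP Mat k), φ 1 = 1 →
    (⟨k, fun i => φ (X.2 i)⟩ : Universe d) ∈ S)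

/-- The first level of `S`, as a subset of `ℂ^d = M_1^d`. -/
def firstLevel {d : ℕ} (S : Set (Universe d)) : Set (Fin d → ℂ) :=
  {z | (⟨1, fun i => z i • (1 : Mat 1)⟩ : Universe d) ∈ S}

/-- `S` is a selfadjoint matrix convex set whose first level is `K ⊆ ℝ^d`. -/
def IsMatrixConvexOver {d : ℕ} (K : Set (EuclideanSpace ℝ (Fin d))) (S : Set (Universe d)) :
    Prop :=
  S ⊆ saUniverse d ∧ IsMatrixConvex S ∧ firstLevel S = (fun x i => (x i : ℂ)) '' K

/-- The minimal matrix convex set with first level `K` (for `K` closed and convex): the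
intersection of all matrix convex sets with first level `K`. -/
def wmin {d : ℕ} (K : Set (EuclideanSpace ℝ (Fin d))) : Set (Universe d) :=
  ⋂₀ {S | IsMatrixConvexOver K S}

/-- The maximal matrix convex set with first level `K` (for `K` closed and convex): the
union of all matrix convex sets with first level `K`. -/
def wmax {d : ℕ} (K : Set (EuclideanSpace ℝ (Fin d))) : Set (Universe d) :=
  ⋃₀ {S | IsMatrixConvexOver K S}

/-- The selfadjoint polar dual `S^•`. -/
def polar {d : ℕ} (S : Set (Universe d)) : Set (Universe d) :=
  {X | X ∈ saUniverse d ∧ ∀ Y ∈ S, ∑ i, tensor (X.2 i) (Y.2 i) ≤ 1}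

/-- The closed Euclidean unit ball of `ℝ^d`. -/
def unitBall (d : ℕ) : Set (EuclideanSpace ℝ (Fin d)) := Metric.closedBall 0 1

/-- `𝔅 = {X : ∑ X_i² ≤ 1}`. -/
def ballB (d : ℕ) : Set (Universe d) := {X | X ∈ saUniverse d ∧ ∑ i, X.2 i ^ 2 ≤ 1}

/-- `𝔇 = {X : ∑ X_i ⊗ conj X_i ≤ 1}`, where `conj` is the entrywise complex conjugate. -/
def ballD (d : ℕ) : Set (Universe d) :=
  {X | X ∈ saUniverse d ∧ ∑ i, tensor (X.2 i) ((X.2 i).map (starRingEnd ℂ)) ≤ 1}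

/-! ### Matrix ranges and free spectrahedra of operator tuples -/

section Operators

variable {H : Type*} [NormedAddCommGroup H] [InnerProductSpace ℂ H] [CompleteSpace H]

/-- The matrix range `𝒲(A)`: all tuples `(φ(A_1), …, φ(A_d))` with `φ : B(H) → M_n` unital
completely positive. -/
def matrixRange {d : ℕ} (A : Fin d → H →L[ℂ] H) : Set (Universe d) :=
  {X | ∃ φ : (H →L[ℂ] H) →CP Mat X.1, φ 1 = 1 ∧ ∀ i, X.2 i = φ (A i)}

/-- The free spectrahedron `𝒟_A^sa` of a tuple `A` of selfadjoint operators. -/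
def freeSpectrahedron {d : ℕ} (A : Fin d → H →L[ℂ] H) : Set (Universe d) :=
  {X | X ∈ saUniverse d ∧ ∑ i, tensor (X.2 i) (A i) ≤ 1}

end Operators

/-! ### The free semicircular tuple on the full Fock space -/

/-- The full Fock space `⨁_n (ℂ^d)^{⊗ n}` (Hilbert space direct sum), realized as `ℓ²` of the set
of words: the standard basis vector at the word `[i₁, …, iₙ]` is `e_{i₁} ⊗ ⋯ ⊗ e_{iₙ}`, and the
one at the empty word is the vacuum vector `Ω`. -/
abbrev Fock (d : ℕ) : Type := lp (fun _ : List (Fin d) => ℂ) 2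

/-- The basis vector `e_{i₁} ⊗ ⋯ ⊗ e_{iₙ}` of the Fock space. -/
def basisVec {d : ℕ} (w : List (Fin d)) : Fock d := lp.single 2 w 1

theorem orthonormal_basisVec (d : ℕ) :
    Orthonormal ℂ (basisVec : List (Fin d) → Fock d) := by
  rw [orthonormal_iff_ite]
  intro v w
  simp only [basisVec, lp.inner_single_left, lp.single_apply]
  by_cases h : v = w
  · subst h; simp
  · simp [h]

theorem orthonormal_basisVec_cons {d : ℕ} (i : Fin d) :
    Orthonormal ℂ (fun w : List (Fin d) => basisVec (i :: w)) :=
  (orthonormal_basisVec d).comp (fun w => i :: w) (List.cons_injective)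

/-- The creation operator (free shift) `ℓ_i`, `ℓ_i (x₁ ⊗ ⋯ ⊗ xₙ) = e_i ⊗ x₁ ⊗ ⋯ ⊗ xₙ`: the
isometry that sends the basis vector at the word `w` to the one at `i :: w`. -/
def creation {d : ℕ} (i : Fin d) : Fock d →L[ℂ] Fock d :=
  (orthonormal_basisVec_cons i).orthogonalFamily.linearIsometry.toContinuousLinearMap

theorem creation_basisVec {d : ℕ} (i : Fin d) (w : List (Fin d)) :
    creation i (basisVec w) = basisVec (i :: w) := by
  have h := (orthonormal_basisVec_cons i).orthogonalFamily.linearIsometry_apply_single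
    (i := w) (1 : ℂ)
  exact h.trans (by simp)

/-- The free semicircular tuple `s_i = ℓ_i + ℓ_i⋆` (of variance one: `‖s_i‖ = 2`). -/
def semicircular (d : ℕ) (i : Fin d) : Fock d →L[ℂ] Fock d := creation i + star (creation i)

/-- The tuple `s/2`. -/
def halfSemicircular (d : ℕ) (i : Fin d) : Fock d →L[ℂ] Fock d := (1 / 2 : ℂ) • semicircular d i

/-- The Lehner ball `ℒ = 𝒟_{s/2}^sa = {X : ∑ X_i ⊗ s_i/2 ≤ I}`. -/
def lehnerBall (d : ℕ) : Set (Universe d) := freeSpectrahedron (halfSemicircular d)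

/-- The matrix range `𝒲(s/2)`. -/
def semicircularRange (d : ℕ) : Set (Universe d) := matrixRange (halfSemicircular d)

end MatrixBall

end

open scoped ComplexOrder CStarAlgebra

noncomputable section

namespace MatrixBall

/-! Write 𝔅 for the ball, ℒ for the Lehner ball and 𝒲 for the matrix range of s/2. Three facts carry
the theorem.

Pairing: if X ∈ ℒ and Z ∈ 𝒲, then ∑ X_i ⊗ Z_i ≤ 1, since Z is a UCP image of s/2 and the defining
inequality of X survives the amplified map. Hence 𝔅 ⊆ 𝒲 gives ℒ ⊆ 𝔅^•, and 𝔅 ⊆ ℒ gives 𝒲 ⊆ 𝔅^• after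
flipping the tensor factors.

Producing points: by completing a square, X lies in ℒ as soon as ∑ X_i a X_i + a⁻¹ ≤ 2 for some
positive invertible a (`mem_lehnerBall_of_le`); a = 1 gives 𝔅 ⊆ ℒ. By a Poisson kernel argument, the
real parts of every row contraction lie in 𝒲 (`half_add_star_mem_ucpImages`); a selfadjoint row
contraction is its own real part, so 𝔅 ⊆ 𝒲.

Separating: the tuple `rowColumn` pairs with Y to at most 1 exactly when ∑ Y_i² ≤ 1. So it lies in
𝔅^•. If it were in ℒ, pairing would force 𝒲 ⊆ 𝔅; if it were in 𝒲, it would force ℒ ⊆ 𝔅. Both fail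
because of the 2 × 2 points `pairPt e p`: p = 1 lies in 𝒲, p = 9/10 in ℒ, and neither in 𝔅.
Parameters p and q pair to at most 1 iff pq ≤ 15/16. As these matrices are real, membership in 𝔇 is
p² ≤ 15/16, which excludes p = 1; and p = 19/20 is in 𝔇 but pairs badly with p = 1, so it is not in
ℒ.

The bounds by the minimal and maximal sets hold because 𝔅 and 𝔅^• are themselves matrix convex with
first level the unit ball. -/

theorem exists_star_mul_self {A : Type*} [CStarAlgebra A] [PartialOrder A] [StarOrderedRing A]
    {a : A} (ha : 0 ≤ a) : ∃ b : A, a = star b * b :=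
  CStarAlgebra.nonneg_iff_eq_star_mul_self.mp ha

/-! ### Elementary tensors -/

section Tensor

variable {A : Type*} [CStarAlgebra A] {n : ℕ}

theorem tensor_apply (x : Mat n) (a : A) (k l : Fin n) : tensor x a k l = x k l • a := rfl

theorem tensor_mul_tensor (x y : Mat n) (a b : A) :
    tensor x a * tensor y b = tensor (x * y) (a * b) := by
  ext k l
  simp only [CStarMatrix.mul_apply, tensor_apply, Finset.sum_smul, smul_mul_smul_comm]

theorem star_tensor (x : Mat n) (a : A) : star (tensor x a) = tensor (star x) (star a) := by
  ext k l
  simp [CStarMatrix.star_apply, tensor_apply]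

theorem tensor_one_one : tensor (1 : Mat n) (1 : A) = 1 := by
  ext k l
  by_cases h : k = l <;> simp [tensor_apply, CStarMatrix.one_apply, h]

theorem add_tensor (x y : Mat n) (a : A) : tensor (x + y) a = tensor x a + tensor y a := by
  ext k l
  simp [tensor_apply, add_smul]

theorem sub_tensor (x y : Mat n) (a : A) : tensor (x - y) a = tensor x a - tensor y a := by
  ext k l
  simp [tensor_apply, sub_smul]

theorem tensor_add (x : Mat n) (a b : A) : tensor x (a + b) = tensor x a + tensor x b := by
  ext k l
  simp [tensor_apply]

theorem tensor_sub (x : Mat n) (a b : A) : tensor x (a - b) = tensor x a - tensor x b := by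
  ext k l
  simp [tensor_apply, smul_sub]

theorem zero_tensor (a : A) : tensor (0 : Mat n) a = 0 := by
  ext k l
  simp [tensor_apply]

theorem tensor_zero (x : Mat n) : tensor x (0 : A) = 0 := by
  ext k l
  simp [tensor_apply]

theorem smul_tensor (c : ℂ) (x : Mat n) (a : A) : tensor (c • x) a = c • tensor x a := by
  ext k l
  simp [tensor_apply, mul_smul]

theorem tensor_smul (c : ℂ) (x : Mat n) (a : A) : tensor x (c • a) = c • tensor x a := by
  ext k l
  simp [tensor_apply, smul_comm c]

theorem sum_apply {m : Type*} {ι : Type*} (s : Finset ι) (f : ι → CStarMatrix m m A) (k l : m) :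
    (∑ i ∈ s, f i) k l = ∑ i ∈ s, f i k l := by
  classical
  induction s using Finset.induction_on with
  | empty => simp
  | insert a s ha ih => simp [Finset.sum_insert ha, ih]

theorem sum_tensor {ι : Type*} (s : Finset ι) (x : ι → Mat n) (a : A) :
    tensor (∑ i ∈ s, x i) a = ∑ i ∈ s, tensor (x i) a := by
  ext k l
  simp [tensor_apply, sum_apply, Finset.sum_smul]

theorem tensor_sum {ι : Type*} (s : Finset ι) (x : Mat n) (a : ι → A) :
    tensor x (∑ i ∈ s, a i) = ∑ i ∈ s, tensor x (a i) := by
  ext k l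
  simp [tensor_apply, sum_apply, Finset.smul_sum]

variable [PartialOrder A] [StarOrderedRing A]

theorem tensor_one_nonneg {x : Mat n} (hx : 0 ≤ x) : 0 ≤ tensor x (1 : A) := by
  obtain ⟨y, rfl⟩ := exists_star_mul_self hx
  have : tensor (star y * y) (1 : A) = star (tensor y 1) * tensor y 1 := by
    rw [star_tensor, tensor_mul_tensor, star_one, one_mul]
  rw [this]
  exact star_mul_self_nonneg _

theorem tensor_nonneg {x : Mat n} {a : A} (hx : 0 ≤ x) (ha : 0 ≤ a) : 0 ≤ tensor x a := by
  obtain ⟨y, rfl⟩ := exists_star_mul_self hx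
  obtain ⟨b, rfl⟩ := exists_star_mul_self ha
  rw [← tensor_mul_tensor, ← star_tensor]
  exact star_mul_self_nonneg _

theorem diag_nonneg {m : Type*} [Fintype m] [DecidableEq m] {M : CStarMatrix m m A}
    (hM : 0 ≤ M) (i : m) : 0 ≤ M i i := by
  obtain ⟨N, rfl⟩ := exists_star_mul_self hM
  rw [CStarMatrix.mul_apply]
  exact Finset.sum_nonneg fun j _ => star_mul_self_nonneg (N j i)

end Tensor

/-! ### The flip of the tensor factors -/

section Flip

variable {n m : ℕ}

/-- The flip `M_n(M_m) → M_m(M_n)`. -/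
def flip (M : CStarMatrix (Fin n) (Fin n) (Mat m)) : CStarMatrix (Fin m) (Fin m) (Mat n) :=
  CStarMatrix.ofMatrix (Matrix.of fun i j =>
    CStarMatrix.ofMatrix (Matrix.of fun k l => M k l i j))

theorem flip_apply (M : CStarMatrix (Fin n) (Fin n) (Mat m)) (i j : Fin m) (k l : Fin n) :
    flip M i j k l = M k l i j := rfl

theorem flip_star_mul (M N : CStarMatrix (Fin n) (Fin n) (Mat m)) :
    flip (star M * N) = star (flip M) * flip N := by
  ext i j k l
  simp only [flip_apply, CStarMatrix.mul_apply, CStarMatrix.star_apply, sum_apply]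
  exact Finset.sum_comm

theorem flip_nonneg {M : CStarMatrix (Fin n) (Fin n) (Mat m)} (hM : 0 ≤ M) : 0 ≤ flip M := by
  obtain ⟨N, rfl⟩ := exists_star_mul_self hM
  rw [flip_star_mul]
  exact star_mul_self_nonneg _

theorem flip_one_sub_sum_tensor {ι : Type*} (s : Finset ι) (x : ι → Mat n) (y : ι → Mat m) :
    flip (1 - ∑ i ∈ s, tensor (x i) (y i)) = 1 - ∑ i ∈ s, tensor (y i) (x i) := by
  rw [← tensor_one_one (n := n) (A := Mat m), ← tensor_one_one (n := m) (A := Mat n)]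
  ext i j k l
  simp only [flip_apply, CStarMatrix.sub_apply, sum_apply, tensor_apply, CStarMatrix.smul_apply,
    smul_eq_mul, mul_comm (x _ _ _), mul_comm ((1 : Mat n) _ _)]

/-- Makes the pairing of matrix tuples symmetric, so that a UCP map can be applied to either tensor
factor. -/
theorem sum_tensor_le_one_comm {ι : Type*} {s : Finset ι} {x : ι → Mat n} {y : ι → Mat m}
    (h : ∑ i ∈ s, tensor (x i) (y i) ≤ 1) : ∑ i ∈ s, tensor (y i) (x i) ≤ 1 := by
  rw [← sub_nonneg] at h ⊢
  rw [← flip_one_sub_sum_tensor]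
  exact flip_nonneg h

end Flip

/-! ### Completely positive maps -/

section CompletelyPositive

variable {A B : Type*} [CStarAlgebra A] [PartialOrder A] [StarOrderedRing A]
  [CStarAlgebra B] [PartialOrder B] [StarOrderedRing B]

theorem sum_tensor_map_le_one {n : ℕ} {ι : Type*} {s : Finset ι} {x : ι → Mat n} {a : ι → A}
    (φ : A →CP B) (hφ : φ 1 = 1) (h : ∑ i ∈ s, tensor (x i) (a i) ≤ 1) :
    ∑ i ∈ s, tensor (x i) (φ (a i)) ≤ 1 := by
  rw [← sub_nonneg] at h ⊢
  have h' := φ.map_cstarMatrix_nonneg _ h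
  convert h' using 1
  rw [← tensor_one_one (n := n) (A := A), ← tensor_one_one (n := n) (A := B)]
  ext k l
  simp only [CStarMatrix.sub_apply, sum_apply, tensor_apply, CStarMatrix.map_apply, map_sub,
    map_sum, map_smul, hφ]

theorem isSelfAdjoint_map (φ : A →CP B) {a : A} (ha : IsSelfAdjoint a) : IsSelfAdjoint (φ a) := by
  rw [← CFC.posPart_sub_negPart a ha, map_sub]
  exact (IsSelfAdjoint.of_nonneg (map_nonneg φ (CFC.posPart_nonneg a))).sub
    (IsSelfAdjoint.of_nonneg (map_nonneg φ (CFC.negPart_nonneg a)))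

/-- The Kadison inequality. -/
theorem map_sq_le (φ : A →CP B) (hφ : φ 1 = 1) {a : A} (ha : IsSelfAdjoint a) :
    φ a ^ 2 ≤ φ (a ^ 2) := by
  -- `star R * R` is the positive matrix with rows (1, a) and (a, a²). Compressing its image under φ
  -- to the column (-φ a, 1) of `Q` leaves φ(a²) - φ(a)².
  let R : CStarMatrix (Fin 2) (Fin 2) A := CStarMatrix.ofMatrix !![1, a; 0, 0]
  let Q : CStarMatrix (Fin 2) (Fin 2) B := CStarMatrix.ofMatrix !![-φ a, 0; 1, 0]
  have hQ := star_left_conjugate_nonneg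
    (φ.map_cstarMatrix_nonneg _ (star_mul_self_nonneg R)) Q
  have h00 := diag_nonneg hQ 0
  have hb := isSelfAdjoint_map φ ha
  simp [CStarMatrix.mul_apply, CStarMatrix.star_apply, Fin.sum_univ_two, R, Q, hφ, ha.star_eq,
    hb.star_eq, CStarMatrix.ofMatrix_apply, ← sq] at h00
  exact h00

/-- Only some bound uniform in φ is needed, for compactness; the crude constant 4 comes from
splitting a into four positive parts. -/
theorem norm_map_le (φ : A →CP B) (hφ : φ 1 = 1) (a : A) : ‖φ a‖ ≤ 4 * ‖a‖ := by
  have hp : ∀ x : A, 0 ≤ x → ‖φ x‖ ≤ ‖x‖ := fun x hx => by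
    have h := PositiveLinearMap.norm_apply_le_of_nonneg (.ofClass φ : A →ₚ[ℂ] B) x hx
    refine h.trans ?_
    change ‖φ 1‖ * ‖x‖ ≤ _
    rw [hφ]
    refine mul_le_of_le_one_left (norm_nonneg _) ?_
    cases subsingleton_or_nontrivial B
    · simp [Subsingleton.elim (1 : B) 0]
    · exact CStarRing.norm_one.le
  obtain ⟨y, hy0, hyn, hy⟩ := CStarAlgebra.exists_sum_four_nonneg a
  calc ‖φ a‖ = ‖∑ i : Fin 4, Complex.I ^ (i : ℕ) • φ (y i)‖ := by
        conv_lhs => rw [hy]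
        simp only [map_sum, map_smul]
    _ ≤ ∑ i : Fin 4, ‖a‖ := norm_sum_le_of_le _ fun i _ => by
        simpa [norm_smul] using (hp _ (hy0 i)).trans (hyn i)
    _ = 4 * ‖a‖ := by simp

end CompletelyPositive

/-! ### Block diagonal sums -/

section BlockDiag

variable {A : Type*} [CStarAlgebra A] {n m : ℕ}

/-- The block diagonal sum of two square matrices over `A`. -/
def blockDiag (x : CStarMatrix (Fin n) (Fin n) A) (y : CStarMatrix (Fin m) (Fin m) A) :
    CStarMatrix (Fin (n + m)) (Fin (n + m)) A :=
  CStarMatrix.ofMatrix (Matrix.reindex finSumFinEquiv finSumFinEquiv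
    (Matrix.fromBlocks (CStarMatrix.ofMatrix.symm x) 0 0 (CStarMatrix.ofMatrix.symm y)))

variable (x x' : CStarMatrix (Fin n) (Fin n) A) (y y' : CStarMatrix (Fin m) (Fin m) A)

@[simp]
theorem blockDiag_castAdd_castAdd (i j : Fin n) :
    blockDiag x y (Fin.castAdd m i) (Fin.castAdd m j) = x i j := by
  simp [blockDiag, CStarMatrix.ofMatrix_apply]

@[simp]
theorem blockDiag_natAdd_natAdd (i j : Fin m) :
    blockDiag x y (Fin.natAdd n i) (Fin.natAdd n j) = y i j := by
  simp [blockDiag, CStarMatrix.ofMatrix_apply]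

@[simp]
theorem blockDiag_castAdd_natAdd (i : Fin n) (j : Fin m) :
    blockDiag x y (Fin.castAdd m i) (Fin.natAdd n j) = 0 := by
  simp [blockDiag, CStarMatrix.ofMatrix_apply]

@[simp]
theorem blockDiag_natAdd_castAdd (i : Fin m) (j : Fin n) :
    blockDiag x y (Fin.natAdd n i) (Fin.castAdd m j) = 0 := by
  simp [blockDiag, CStarMatrix.ofMatrix_apply]

theorem ext_blocks {R : Type*} {M N : CStarMatrix (Fin (n + m)) (Fin (n + m)) R}
    (h₁ : ∀ i j, M (Fin.castAdd m i) (Fin.castAdd m j) = N (Fin.castAdd m i) (Fin.castAdd m j))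
    (h₂ : ∀ i j, M (Fin.castAdd m i) (Fin.natAdd n j) = N (Fin.castAdd m i) (Fin.natAdd n j))
    (h₃ : ∀ i j, M (Fin.natAdd n i) (Fin.castAdd m j) = N (Fin.natAdd n i) (Fin.castAdd m j))
    (h₄ : ∀ i j, M (Fin.natAdd n i) (Fin.natAdd n j) = N (Fin.natAdd n i) (Fin.natAdd n j)) :
    M = N := by
  ext i j
  refine Fin.addCases (fun i => ?_) (fun i => ?_) i <;>
    refine Fin.addCases (fun j => ?_) (fun j => ?_) j
  exacts [h₁ i j, h₂ i j, h₃ i j, h₄ i j]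

theorem blockDiag_mul : blockDiag x y * blockDiag x' y' = blockDiag (x * x') (y * y') := by
  apply ext_blocks <;> intro i j <;> simp [CStarMatrix.mul_apply, Fin.sum_univ_add]

theorem star_blockDiag : star (blockDiag x y) = blockDiag (star x) (star y) := by
  apply ext_blocks <;> intro i j <;> simp [CStarMatrix.star_apply]

theorem blockDiag_one_one :
    blockDiag (1 : CStarMatrix (Fin n) (Fin n) A) (1 : CStarMatrix (Fin m) (Fin m) A) = 1 := by
  apply ext_blocks <;> intro i j
  · by_cases h : i = j <;> simp [h, CStarMatrix.one_apply]
  · rw [CStarMatrix.one_apply_ne]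
    · simp
    · intro h; simpa [Fin.ext_iff] using (show (i : ℕ) ≠ n + j by omega) (congrArg Fin.val h)
  · rw [CStarMatrix.one_apply_ne]
    · simp
    · intro h; simpa [Fin.ext_iff] using (show n + (i : ℕ) ≠ j by omega) (congrArg Fin.val h)
  · by_cases h : i = j <;> simp [h, CStarMatrix.one_apply]

theorem blockDiag_sub : blockDiag x y - blockDiag x' y' = blockDiag (x - x') (y - y') := by
  apply ext_blocks <;> intro i j <;> simp

theorem sum_blockDiag {ι : Type*} (s : Finset ι) (x : ι → CStarMatrix (Fin n) (Fin n) A)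
    (y : ι → CStarMatrix (Fin m) (Fin m) A) :
    ∑ i ∈ s, blockDiag (x i) (y i) = blockDiag (∑ i ∈ s, x i) (∑ i ∈ s, y i) := by
  apply ext_blocks <;> intro i j <;> simp [sum_apply]

theorem tensor_directSum (x : Mat n) (y : Mat m) (a : A) :
    tensor (directSum x y) a = blockDiag (tensor x a) (tensor y a) := by
  have h : directSum x y = blockDiag x y := rfl
  rw [h]
  apply ext_blocks <;> intro i j <;> simp [tensor_apply]

theorem blockDiag_le_one [PartialOrder A] [StarOrderedRing A]
    {x : CStarMatrix (Fin n) (Fin n) A} {y : CStarMatrix (Fin m) (Fin m) A}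
    (hx : x ≤ 1) (hy : y ≤ 1) : blockDiag x y ≤ 1 := by
  rw [← sub_nonneg] at hx hy ⊢
  obtain ⟨a, ha⟩ := exists_star_mul_self hx
  obtain ⟨b, hb⟩ := exists_star_mul_self hy
  rw [← blockDiag_one_one, blockDiag_sub, ha, hb, ← blockDiag_mul, ← star_blockDiag]
  exact star_mul_self_nonneg _

end BlockDiag

/-! ### Matrix convexity of the ball and of polar duals -/

theorem saUniverse_directSum {d : ℕ} {X Y : Universe d} (hX : X ∈ saUniverse d)
    (hY : Y ∈ saUniverse d) :
    (⟨X.1 + Y.1, fun i => directSum (X.2 i) (Y.2 i)⟩ : Universe d) ∈ saUniverse d := fun i => by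
  have := star_blockDiag (X.2 i) (Y.2 i)
  rw [(hX i).star_eq, (hY i).star_eq] at this
  exact this

theorem isMatrixConvex_ballB (d : ℕ) : IsMatrixConvex (ballB d) := by
  refine ⟨fun X hX Y hY => ⟨saUniverse_directSum hX.1 hY.1, ?_⟩,
    fun X hX k φ hφ => ⟨fun i => isSelfAdjoint_map φ (hX.1 i), ?_⟩⟩
  · have : ∑ i, blockDiag (X.2 i) (Y.2 i) ^ 2 ≤ 1 := by
      simp_rw [sq, blockDiag_mul, sum_blockDiag, ← sq]
      exact blockDiag_le_one hX.2 hY.2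
    exact this
  · calc ∑ i, φ (X.2 i) ^ 2 ≤ ∑ i, φ (X.2 i ^ 2) :=
          Finset.sum_le_sum fun i _ => map_sq_le φ hφ (hX.1 i)
      _ = φ (∑ i, X.2 i ^ 2) := (map_sum φ _ _).symm
      _ ≤ φ 1 := OrderHomClass.mono φ hX.2
      _ = 1 := hφ

theorem isMatrixConvex_polar {d : ℕ} (S : Set (Universe d)) : IsMatrixConvex (polar S) := by
  refine ⟨fun X hX Y hY => ⟨saUniverse_directSum hX.1 hY.1, fun Z hZ => ?_⟩,
    fun X hX k φ hφ => ⟨fun i => isSelfAdjoint_map φ (hX.1 i), fun Z hZ => ?_⟩⟩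
  · have : ∑ i, tensor (directSum (X.2 i) (Y.2 i)) (Z.2 i) ≤ 1 := by
      simp_rw [tensor_directSum, sum_blockDiag]
      exact blockDiag_le_one (hX.2 Z hZ) (hY.2 Z hZ)
    exact this
  · exact sum_tensor_le_one_comm (sum_tensor_map_le_one φ hφ (sum_tensor_le_one_comm (hX.2 Z hZ)))

/-! ### First levels -/

theorem ofReal_smul_one_le_one {n : ℕ} {c : ℝ} (hc : c ≤ 1) : (c : ℂ) • (1 : Mat n) ≤ 1 := by
  have h : (1 : Mat n) - (c : ℂ) • 1
      = star (((√(1 - c) : ℝ) : ℂ) • (1 : Mat n)) * (((√(1 - c) : ℝ) : ℂ) • 1) := by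
    rw [star_smul, smul_mul_smul_comm, star_one, one_mul]
    have : star ((√(1 - c) : ℝ) : ℂ) * ((√(1 - c) : ℝ) : ℂ) = ((1 - c : ℝ) : ℂ) := by
      rw [Complex.star_def, Complex.conj_ofReal, ← Complex.ofReal_mul,
        Real.mul_self_sqrt (by linarith)]
    rw [this, Complex.ofReal_sub, sub_smul, Complex.ofReal_one, one_smul]
  rw [← sub_nonneg, h]
  exact star_mul_self_nonneg _

theorem le_one_of_smul_one_le_one {n : ℕ+} {c : ℝ} (h : (c : ℂ) • (1 : Mat n) ≤ 1) : c ≤ 1 := by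
  have h' := diag_nonneg (sub_nonneg.mpr h) ⟨0, n.pos⟩
  rw [CStarMatrix.sub_apply, CStarMatrix.smul_apply, CStarMatrix.one_apply_eq, smul_eq_mul,
    mul_one, sub_nonneg] at h'
  exact_mod_cast h'

theorem exists_ofReal_of_isSelfAdjoint {d : ℕ} {z : Fin d → ℂ}
    (hz : ∀ i, IsSelfAdjoint (z i • (1 : Mat (1 : ℕ+)))) :
    ∃ x : EuclideanSpace ℝ (Fin d), (fun i => (x i : ℂ)) = z := by
  refine ⟨WithLp.toLp 2 fun i => (z i).re, funext fun i => ?_⟩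
  have h := congrArg (fun M : Mat (1 : ℕ+) => M 0 0) (hz i).star_eq
  simp only [CStarMatrix.star_apply, CStarMatrix.smul_apply, CStarMatrix.one_apply_eq,
    smul_eq_mul, mul_one] at h
  exact Complex.conj_eq_iff_re.mp h

theorem isSelfAdjoint_ofReal_smul_one {n : ℕ} (c : ℝ) : IsSelfAdjoint ((c : ℂ) • (1 : Mat n)) := by
  rw [IsSelfAdjoint, star_smul, star_one, Complex.star_def, Complex.conj_ofReal]

theorem mem_unitBall_iff {d : ℕ} {x : EuclideanSpace ℝ (Fin d)} :
    x ∈ unitBall d ↔ ∑ i, x i ^ 2 ≤ 1 := by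
  rw [unitBall, mem_closedBall_zero_iff, EuclideanSpace.norm_eq, Real.sqrt_le_one]
  simp

theorem sum_sq_ofReal_smul_one {n d : ℕ} (x : Fin d → ℝ) :
    ∑ i, ((x i : ℂ) • (1 : Mat n)) ^ 2 = ((∑ i, x i ^ 2 : ℝ) : ℂ) • 1 := by
  simp_rw [smul_pow, one_pow, ← Finset.sum_smul]
  push_cast
  rfl

theorem isMatrixConvexOver_ballB (d : ℕ) : IsMatrixConvexOver (unitBall d) (ballB d) := by
  refine ⟨fun X hX => hX.1, isMatrixConvex_ballB d, Set.ext fun z => ⟨fun hz => ?_, ?_⟩⟩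
  · obtain ⟨x, rfl⟩ := exists_ofReal_of_isSelfAdjoint hz.1
    refine ⟨x, mem_unitBall_iff.mpr ?_, rfl⟩
    have h : ∑ i, ((x i : ℂ) • (1 : Mat (1 : ℕ+))) ^ 2 ≤ 1 := hz.2
    rw [sum_sq_ofReal_smul_one] at h
    exact le_one_of_smul_one_le_one h
  · rintro ⟨x, hx, rfl⟩
    refine ⟨fun i => isSelfAdjoint_ofReal_smul_one _, ?_⟩
    change ∑ i, ((x i : ℂ) • (1 : Mat (1 : ℕ+))) ^ 2 ≤ 1
    rw [sum_sq_ofReal_smul_one]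
    exact ofReal_smul_one_le_one (mem_unitBall_iff.mp hx)

/-- Cauchy–Schwarz in the form 2 x_i Y_i ≤ x_i² + Y_i², obtained by expanding ∑ (x_i - Y_i)² ≥ 0. -/
theorem sum_smul_le_one {n d : ℕ} {x : Fin d → ℝ} {Y : Fin d → Mat n}
    (hY : ∀ i, IsSelfAdjoint (Y i)) (hx : ∑ i, x i ^ 2 ≤ 1) (h : ∑ i, Y i ^ 2 ≤ 1) :
    ∑ i, (x i : ℂ) • Y i ≤ 1 := by
  have hsq : 0 ≤ ∑ i, ((x i : ℂ) • 1 - Y i) ^ 2 :=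
    Finset.sum_nonneg fun i _ => ((isSelfAdjoint_ofReal_smul_one _).sub (hY i)).sq_nonneg
  have hx' := sub_nonneg.mpr (ofReal_smul_one_le_one (n := n) hx)
  have h' := sub_nonneg.mpr h
  have hsum := add_nonneg (add_nonneg hsq hx') h'
  have key : ∑ i, ((x i : ℂ) • 1 - Y i) ^ 2 + (1 - ((∑ i, x i ^ 2 : ℝ) : ℂ) • 1)
      + (1 - ∑ i, Y i ^ 2) = (1 - ∑ i, (x i : ℂ) • Y i) + (1 - ∑ i, (x i : ℂ) • Y i) := by
    rw [← sum_sq_ofReal_smul_one]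
    have : ∀ i, ((x i : ℂ) • 1 - Y i) ^ 2
        = ((x i : ℂ) • 1) ^ 2 + Y i ^ 2 - (x i : ℂ) • Y i - (x i : ℂ) • Y i := fun i => by
      simp only [sq, sub_mul, mul_sub, smul_mul_assoc, mul_smul_comm, one_mul, mul_one,
        smul_sub]
      abel
    simp_rw [this, Finset.sum_sub_distrib, Finset.sum_add_distrib]
    abel
  rw [key] at hsum
  rw [← sub_nonneg]
  have := smul_nonneg (show (0 : ℝ) ≤ 1 / 2 by norm_num) hsum
  rwa [← two_smul ℝ, smul_smul, show (1 / 2 * 2 : ℝ) = 1 by norm_num, one_smul] at this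

theorem isMatrixConvexOver_polar_ballB (d : ℕ) :
    IsMatrixConvexOver (unitBall d) (polar (ballB d)) := by
  refine ⟨fun X hX => hX.1, isMatrixConvex_polar _, Set.ext fun z => ⟨fun hz => ?_, ?_⟩⟩
  · obtain ⟨x, rfl⟩ := exists_ofReal_of_isSelfAdjoint hz.1
    refine ⟨x, ?_, rfl⟩
    rw [unitBall, mem_closedBall_zero_iff]
    by_contra! hx
    have hsum : ∑ i, x i ^ 2 = ‖x‖ ^ 2 := by simp [EuclideanSpace.norm_sq_eq]
    have h0 : ‖x‖ ≠ 0 := by positivity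
    -- A scalar point outside the unit ball is excluded by its own normalization x/‖x‖, with which
    -- it pairs to ‖x‖ > 1.
    have hy : (⟨1, fun i => ((x i / ‖x‖ : ℝ) : ℂ) • (1 : Mat (1 : ℕ+))⟩ : Universe d)
        ∈ ballB d := by
      refine ⟨fun i => isSelfAdjoint_ofReal_smul_one _, ?_⟩
      dsimp only
      rw [sum_sq_ofReal_smul_one]
      refine ofReal_smul_one_le_one ?_
      simp_rw [div_pow, ← Finset.sum_div, hsum]
      rw [div_self (by positivity)]
    have h := hz.2 _ hy
    have e : ∑ i, tensor ((x i : ℂ) • (1 : Mat (1 : ℕ+)))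
        (((x i / ‖x‖ : ℝ) : ℂ) • (1 : Mat (1 : ℕ+))) = tensor ((‖x‖ : ℂ) • 1) 1 := by
      simp_rw [tensor_smul, smul_tensor, smul_smul, ← Finset.sum_smul]
      congr 1
      rw [← Complex.ofReal_inj.mpr (show ∑ i, (x i / ‖x‖) * x i = ‖x‖ by
        simp_rw [div_mul_eq_mul_div, ← sq, ← Finset.sum_div, hsum]
        field_simp)]
      push_cast
      rfl
    have h2 := diag_nonneg (sub_nonneg.mpr (e ▸ h)) 0
    rw [CStarMatrix.sub_apply, tensor_apply, CStarMatrix.smul_apply, CStarMatrix.one_apply_eq,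
      CStarMatrix.one_apply_eq, sub_nonneg, smul_eq_mul, mul_one] at h2
    exact absurd (le_one_of_smul_one_le_one h2) hx.not_ge
  · rintro ⟨x, hx, rfl⟩
    refine ⟨fun i => isSelfAdjoint_ofReal_smul_one _, fun Y hY => ?_⟩
    change ∑ i, tensor ((x i : ℂ) • (1 : Mat (1 : ℕ+))) (Y.2 i) ≤ 1
    simp_rw [smul_tensor, ← tensor_smul, ← tensor_sum]
    rw [← tensor_one_one (n := (1 : ℕ+)) (A := Mat Y.1), ← sub_nonneg, ← tensor_sub]
    exact tensor_nonneg zero_le_one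
      (sub_nonneg.mpr (sum_smul_le_one hY.1 (mem_unitBall_iff.mp hx) hY.2))

/-! ### The free shifts -/

section Fock

variable {d : ℕ}

theorem dense_span_basisVec (d : ℕ) :
    Dense (Submodule.span ℂ (Set.range (basisVec : List (Fin d) → Fock d)) : Set (Fock d)) := by
  have h := (HilbertBasis.ofRepr (LinearIsometryEquiv.refl ℂ (Fock d))).dense_span
  rw [← Submodule.dense_iff_topologicalClosure_eq_top] at h
  have e : (basisVec : List (Fin d) → Fock d)
      = HilbertBasis.ofRepr (LinearIsometryEquiv.refl ℂ (Fock d)) := funext fun w => by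
    rw [← HilbertBasis.repr_symm_single]
    rfl
  rwa [e]

theorem star_creation_mul_creation (i j : Fin d) :
    star (creation i) * creation j = if i = j then 1 else 0 := by
  refine ContinuousLinearMap.ext_on (dense_span_basisVec d) ?_
  rintro _ ⟨w, rfl⟩
  rw [mul_apply_eq_comp, creation_basisVec]
  refine (dense_span_basisVec d).eq_of_inner_right (𝕜 := ℂ) fun v hv => ?_
  induction hv using Submodule.span_induction with
  | mem x hx =>
    obtain ⟨u, rfl⟩ := hx
    rw [ContinuousLinearMap.star_eq_adjoint, ContinuousLinearMap.adjoint_inner_right,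
      creation_basisVec, orthonormal_iff_ite.mp (orthonormal_basisVec d)]
    by_cases h : i = j
    · simp [h, orthonormal_iff_ite.mp (orthonormal_basisVec d)]
    · simp [h]
  | zero => simp
  | add x y _ _ hx hy => rw [inner_add_left, inner_add_left, hx, hy]
  | smul c x _ hx => rw [inner_smul_left, inner_smul_left, hx]

theorem star_creation_vacuum (i : Fin d) : star (creation i) (basisVec []) = 0 := by
  refine (dense_span_basisVec d).eq_of_inner_right (𝕜 := ℂ) fun v hv => ?_
  induction hv using Submodule.span_induction with
  | mem x hx =>
    obtain ⟨u, rfl⟩ := hx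
    rw [ContinuousLinearMap.star_eq_adjoint, ContinuousLinearMap.adjoint_inner_right,
      creation_basisVec, orthonormal_iff_ite.mp (orthonormal_basisVec d)]
    simp
  | zero => simp
  | add x y _ _ hx hy => rw [inner_add_left, inner_add_left, hx, hy]
  | smul c x _ hx => rw [inner_smul_left, inner_smul_left, hx]

theorem isSelfAdjoint_halfSemicircular (i : Fin d) : IsSelfAdjoint (halfSemicircular d i) := by
  rw [IsSelfAdjoint, halfSemicircular, semicircular, star_smul, star_add, star_star, add_comm]
  congr 1
  simp

end Fock

/-! ### Membership in the Lehner ball -/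

section Lehner

variable {A : Type*} [CStarAlgebra A] [PartialOrder A] [StarOrderedRing A] {n d : ℕ}

theorem half_smul_nonneg {x : A} (hx : 0 ≤ x) : 0 ≤ (1 / 2 : ℂ) • x := by
  have h := smul_nonneg (show (0 : ℝ) ≤ 1 / 2 by norm_num) hx
  rw [← Complex.coe_smul] at h
  norm_num at h ⊢
  exact h

/-- Put Y = ∑ x_i ⊗ l_i, T = a ⊗ 1 and S = b ⊗ 1 = T⁻¹. The isometry relations collapse Y⋆TY to (∑
x_i a x_i) ⊗ 1, and 0 ≤ (Y - S)⋆T(Y - S) = Y⋆TY - Y - Y⋆ + S then bounds Y + Y⋆ by 2. -/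
theorem sum_tensor_half_add_star_le_one {l : Fin d → A}
    (hl : ∀ i j, star (l i) * l j = if i = j then 1 else 0) {x : Fin d → Mat n}
    (hx : ∀ i, IsSelfAdjoint (x i)) {a b : Mat n} (ha : 0 ≤ a) (hb : IsSelfAdjoint b)
    (hab : a * b = 1) (hba : b * a = 1) (h : ∑ i, x i * a * x i + b ≤ 2) :
    ∑ i, tensor (x i) ((1 / 2 : ℂ) • (l i + star (l i))) ≤ 1 := by
  set Y : CStarMatrix (Fin n) (Fin n) A := ∑ i, tensor (x i) (l i) with hY
  set T : CStarMatrix (Fin n) (Fin n) A := tensor a 1 with hT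
  set S : CStarMatrix (Fin n) (Fin n) A := tensor b 1 with hS
  have hYs : star Y = ∑ i, tensor (x i) (star (l i)) := by
    simp_rw [hY, star_sum, star_tensor, (hx _).star_eq]
  have hTS : T * S = 1 := by rw [hT, hS, tensor_mul_tensor, hab, one_mul, tensor_one_one]
  have hST : S * T = 1 := by rw [hT, hS, tensor_mul_tensor, hba, one_mul, tensor_one_one]
  have hSs : star S = S := by rw [hS, star_tensor, hb.star_eq, star_one]
  have hYTY : star Y * T * Y = tensor (∑ i, x i * a * x i) 1 := by
    rw [hYs, hY, hT, Finset.sum_mul, Finset.sum_mul, sum_tensor]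
    refine Finset.sum_congr rfl fun i _ => ?_
    rw [Finset.mul_sum, Finset.sum_eq_single i]
    · rw [tensor_mul_tensor, tensor_mul_tensor, mul_one, hl, if_pos rfl]
    · intro j _ hj
      rw [tensor_mul_tensor, tensor_mul_tensor, mul_one, hl, if_neg hj.symm, tensor_zero]
    · simp
  have h1 : 0 ≤ star (Y - S) * T * (Y - S) :=
    star_left_conjugate_nonneg (tensor_one_nonneg ha) _
  have h2 : 0 ≤ tensor (2 - (∑ i, x i * a * x i + b)) (1 : A) :=
    tensor_one_nonneg (sub_nonneg.mpr h)
  have key : star (Y - S) * T * (Y - S) + tensor (2 - (∑ i, x i * a * x i + b)) (1 : A)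
      = 2 - (Y + star Y) := by
    have e : star (Y - S) * T * (Y - S) = star Y * T * Y - Y - star Y + S := by
      rw [star_sub, hSs, sub_mul, hST, sub_mul, mul_sub, mul_assoc (star Y) T S, hTS, mul_one,
        one_mul]
      abel
    rw [e, hYTY, sub_tensor, add_tensor, ← one_add_one_eq_two, add_tensor, tensor_one_one,
      ← one_add_one_eq_two]
    abel
  have h3 := add_nonneg h1 h2
  rw [key] at h3
  have h4 := half_smul_nonneg h3
  have e : ∑ i, tensor (x i) ((1 / 2 : ℂ) • (l i + star (l i))) = (1 / 2 : ℂ) • (Y + star Y) := by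
    simp_rw [hYs, hY, tensor_smul, tensor_add, ← Finset.smul_sum, Finset.sum_add_distrib]
  rw [e, ← sub_nonneg]
  convert h4 using 1
  have e2 : (2 : CStarMatrix (Fin n) (Fin n) A) = (2 : ℂ) • 1 := by
    rw [two_smul, one_add_one_eq_two]
  rw [smul_sub, e2, smul_smul, show (1 / 2 * 2 : ℂ) = 1 by norm_num, one_smul]

theorem mem_lehnerBall_of_le {X : Universe d} (hX : X ∈ saUniverse d) {a b : Mat X.1}
    (ha : 0 ≤ a) (hb : IsSelfAdjoint b) (hab : a * b = 1) (hba : b * a = 1)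
    (h : ∑ i, X.2 i * a * X.2 i + b ≤ 2) : X ∈ lehnerBall d :=
  ⟨hX, sum_tensor_half_add_star_le_one star_creation_mul_creation hX ha hb hab hba h⟩

theorem ballB_subset_lehnerBall (d : ℕ) : ballB d ⊆ lehnerBall d := fun X hX =>
  mem_lehnerBall_of_le hX.1 zero_le_one (IsSelfAdjoint.one _) (one_mul 1) (one_mul 1) (by
    simp_rw [mul_one, ← sq]
    exact (add_le_add_left hX.2 1).trans_eq one_add_one_eq_two)

theorem sum_tensor_le_one_of_mem_lehnerBall {X Z : Universe d} (hX : X ∈ lehnerBall d)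
    (hZ : Z ∈ semicircularRange d) : ∑ i, tensor (X.2 i) (Z.2 i) ≤ 1 := by
  obtain ⟨φ, hφ, hφZ⟩ := hZ
  simp_rw [hφZ]
  exact sum_tensor_map_le_one φ hφ hX.2

theorem semicircularRange_subset_saUniverse (d : ℕ) : semicircularRange d ⊆ saUniverse d := by
  rintro X ⟨φ, -, hφ⟩ i
  rw [hφ]
  exact isSelfAdjoint_map φ (isSelfAdjoint_halfSemicircular i)

end Lehner

/-! ### The self-dual description of the ball -/

section RowColumn

variable {A : Type*} [CStarAlgebra A] {n d : ℕ}

/-- The matrix unit `e_{ij}`. -/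
def matUnit (i j : Fin n) : Mat n := CStarMatrix.ofMatrix (Matrix.single i j 1)

theorem matUnit_mul_matUnit (i j k l : Fin n) :
    matUnit i j * matUnit k l = if j = k then matUnit i l else 0 := by
  split_ifs with h
  · subst h
    exact (Matrix.single_mul_single_same (α := ℂ) (c := 1) ..).trans (by rw [one_mul]; rfl)
  · exact Matrix.single_mul_single_of_ne (α := ℂ) (c := 1) (h := h) ..

theorem star_matUnit (i j : Fin n) : star (matUnit i j) = matUnit j i :=
  (Matrix.conjTranspose_single (α := ℂ) ..).trans (by rw [star_one]; rfl)

theorem sum_matUnit_diag : ∑ i : Fin n, matUnit i i = 1 := by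
  ext k l
  rw [sum_apply]
  simp only [matUnit, CStarMatrix.ofMatrix_apply, Matrix.single_apply, CStarMatrix.one_apply]
  by_cases h : k = l
  · subst h; simp
  · simp only [h, if_false]
    exact Finset.sum_eq_zero fun i _ => if_neg fun hi => h (hi.1.symm.trans hi.2)

theorem matUnit_diag_nonneg (i : Fin n) : 0 ≤ matUnit i i := by
  have : matUnit i i = star (matUnit i i) * matUnit i i := by rw [star_matUnit, matUnit_mul_matUnit, if_pos rfl]
  rw [this]
  exact star_mul_self_nonneg _

/-- The tuple `e_{0i} + e_{i0}` in `M_{d+1}`. -/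
def rowColumn (d : ℕ) (i : Fin d) : Mat (d + 1) := matUnit 0 i.succ + matUnit i.succ 0

theorem isSelfAdjoint_rowColumn (i : Fin d) : IsSelfAdjoint (rowColumn d i) := by
  simp only [IsSelfAdjoint, rowColumn, star_add, star_matUnit, add_comm]

/-- A Schur complement written as a sum of squares: the left side is the arrow matrix with identity
diagonal and border -y_i, and 1 - ∑ y_i² is the complement of its lower block. -/
theorem one_sub_sum_tensor_rowColumn {y : Fin d → A} (hy : ∀ i, IsSelfAdjoint (y i)) :
    1 - ∑ i, tensor (rowColumn d i) (y i)
      = ∑ i, star (tensor (matUnit i.succ i.succ) 1 - tensor (matUnit i.succ 0) (y i))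
          * (tensor (matUnit i.succ i.succ) 1 - tensor (matUnit i.succ 0) (y i))
        + tensor (matUnit 0 0) (1 - ∑ i, y i ^ 2) := by
  have h : ∀ i : Fin d, star (tensor (matUnit i.succ i.succ) 1 - tensor (matUnit i.succ 0) (y i))
      * (tensor (matUnit i.succ i.succ) 1 - tensor (matUnit i.succ 0) (y i))
      = tensor (matUnit i.succ i.succ) 1 - tensor (rowColumn d i) (y i)
        + tensor (matUnit 0 0) (y i ^ 2) := fun i => by
    simp only [star_sub, star_tensor, star_matUnit, star_one, (hy i).star_eq, sub_mul, mul_sub,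
      tensor_mul_tensor, matUnit_mul_matUnit, if_true, one_mul, mul_one, rowColumn, add_tensor, sq]
    abel
  simp_rw [h, Finset.sum_add_distrib, Finset.sum_sub_distrib, tensor_sub, tensor_sum]
  rw [← tensor_one_one, ← sum_matUnit_diag, Fin.sum_univ_succ, add_tensor, sum_tensor]
  abel

variable [PartialOrder A] [StarOrderedRing A]

theorem sum_tensor_rowColumn_le_one {y : Fin d → A} (hy : ∀ i, IsSelfAdjoint (y i))
    (h : ∑ i, y i ^ 2 ≤ 1) : ∑ i, tensor (rowColumn d i) (y i) ≤ 1 := by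
  rw [← sub_nonneg, one_sub_sum_tensor_rowColumn hy]
  exact add_nonneg (Finset.sum_nonneg fun i _ => star_mul_self_nonneg _)
    (tensor_nonneg (matUnit_diag_nonneg 0) (sub_nonneg.mpr h))

theorem sum_sq_le_one_of_sum_tensor_rowColumn_le_one {y : Fin d → A}
    (hy : ∀ i, IsSelfAdjoint (y i)) (h : ∑ i, tensor (rowColumn d i) (y i) ≤ 1) :
    ∑ i, y i ^ 2 ≤ 1 := by
  rw [← sub_nonneg, one_sub_sum_tensor_rowColumn hy] at h
  -- The column (1, y_1, …, y_d) annihilates every square in the identity, so conjugating by it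
  -- isolates the Schur complement.
  set c : CStarMatrix (Fin (d + 1)) (Fin (d + 1)) A :=
    tensor (matUnit 0 0) 1 + ∑ i : Fin d, tensor (matUnit i.succ 0) (y i) with hc
  have hRc : ∀ i : Fin d,
      (tensor (matUnit i.succ i.succ) 1 - tensor (matUnit i.succ 0) (y i)) * c = 0 := fun i => by
    rw [hc, sub_mul, mul_add, mul_add, Finset.mul_sum, Finset.mul_sum]
    simp only [tensor_mul_tensor, matUnit_mul_matUnit, Fin.succ_ne_zero, (Fin.succ_ne_zero _).symm,
      Fin.succ_inj, if_true, if_false, zero_tensor, Finset.sum_const_zero, one_mul, mul_one,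
      add_zero, zero_add]
    rw [Finset.sum_eq_single i (fun j _ hj => by rw [if_neg hj.symm, zero_tensor]) (by simp),
      if_pos rfl, sub_self]
  have hDc : ∀ D : A, tensor (matUnit 0 0) D * c = tensor (matUnit 0 0) D := fun D => by
    rw [hc, mul_add, Finset.mul_sum]
    simp only [tensor_mul_tensor, matUnit_mul_matUnit, (Fin.succ_ne_zero _).symm, if_true,
      if_false, zero_tensor, Finset.sum_const_zero, mul_one, add_zero]
  have hcD : ∀ D : A, star c * tensor (matUnit 0 0) D = tensor (matUnit 0 0) D := fun D => by
    have := congrArg star (hDc (star D))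
    rwa [star_mul, star_tensor, star_matUnit, star_star] at this
  have hconj := star_left_conjugate_nonneg h c
  clear_value c
  rw [mul_add, Finset.mul_sum, add_mul, Finset.sum_mul,
    Finset.sum_eq_zero (fun i _ => by rw [mul_assoc, mul_assoc, hRc, mul_zero, mul_zero]),
    zero_add, hcD, hDc] at hconj
  have h00 := diag_nonneg hconj 0
  rw [tensor_apply] at h00
  simpa [matUnit, CStarMatrix.ofMatrix_apply] using h00

end RowColumn

/-! ### Vector-state type completely positive maps -/

section Gram

variable {H : Type*} [NormedAddCommGroup H] [InnerProductSpace ℂ H] {m n : ℕ}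

/-- The matrix `V⋆ W`, for the operators `V, W : ℂⁿ → H ⊗ ℂᵐ` with columns `ξ`, `η`. -/
def gramMat (ξ η : Fin m → Fin n → H) : Mat n :=
  CStarMatrix.ofMatrix (Matrix.of fun k l => ∑ a, inner ℂ (ξ a k) (η a l))

theorem gramMat_apply (ξ η : Fin m → Fin n → H) (k l : Fin n) :
    gramMat ξ η k l = ∑ a, inner ℂ (ξ a k) (η a l) := rfl

/-- The columns of the composition of an operator `ℂⁿ → H ⊗ ℂᵐ` with a matrix. -/
def comp (ξ : Fin m → Fin n → H) (x : Mat n) : Fin m → Fin n → H :=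
  fun a k => ∑ p, x p k • ξ a p

theorem gramMat_comp (ξ η : Fin m → Fin n → H) (x y : Mat n) :
    gramMat (comp ξ x) (comp η y) = star x * gramMat ξ η * y := by
  ext k l
  simp only [gramMat_apply, comp, sum_inner, inner_sum, inner_smul_left, inner_smul_right,
    CStarMatrix.mul_apply, CStarMatrix.star_apply, Finset.mul_sum, Finset.sum_mul]
  rw [Finset.sum_comm]
  refine Finset.sum_congr rfl fun q _ => ?_
  rw [Finset.sum_comm]
  refine Finset.sum_congr rfl fun p _ => Finset.sum_congr rfl fun a _ => ?_
  rw [starRingEnd_apply]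
  ring

open scoped MatrixOrder in
-- Identifies M_k(M_n) with M_{kn}, so that positivity of block matrices can be checked on Gram
-- matrices.
theorem nonneg_of_posSemidef {k : ℕ} {M : CStarMatrix (Fin k) (Fin k) (Mat n)}
    (h : (Matrix.of fun p q : Fin k × Fin n => M p.1 q.1 p.2 q.2).PosSemidef) : 0 ≤ M := by
  obtain ⟨B, hB⟩ := CStarAlgebra.nonneg_iff_eq_star_mul_self.mp h.nonneg
  let N : CStarMatrix (Fin k) (Fin k) (Mat n) := CStarMatrix.ofMatrix (Matrix.of fun i j =>
    CStarMatrix.ofMatrix (Matrix.of fun p q => B (i, p) (j, q)))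
  have : M = star N * N := by
    ext i j p q
    have h := congrArg (fun L : Matrix (Fin k × Fin n) (Fin k × Fin n) ℂ => L (i, p) (j, q)) hB
    simp only [Matrix.of_apply, Matrix.mul_apply, Fintype.sum_prod_type, Matrix.star_apply] at h
    rw [h, CStarMatrix.mul_apply, sum_apply]
    refine Finset.sum_congr rfl fun a _ => ?_
    rw [CStarMatrix.mul_apply]
    rfl
  rw [this]
  exact star_mul_self_nonneg _

variable [CompleteSpace H]

/-- The completely positive map `a ↦ V⋆ (a ⊗ 1) V` for the operator `V : ℂⁿ → H ⊗ ℂᵐ` with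
columns `ξ`. -/
def compression (ξ : Fin m → Fin n → H) : (H →L[ℂ] H) →CP Mat n where
  toFun a := gramMat ξ fun p k => a (ξ p k)
  map_add' a b := by
    ext k l
    simp [gramMat_apply, Finset.sum_add_distrib]
  map_smul' c a := by
    ext k l
    simp [gramMat_apply, Finset.mul_sum]
  map_cstarMatrix_nonneg' k M hM := by
    obtain ⟨N, rfl⟩ := exists_star_mul_self hM
    refine nonneg_of_posSemidef ?_
    -- For M = N⋆N the image is the sum over c and a of the Gram matrices of the vectors N_{c,p}
    -- ξ_{a,q}, indexed by (p, q).
    have h : ∀ (c : Fin k) (a : Fin m),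
        (Matrix.gram ℂ fun p : Fin k × Fin n => N c p.1 (ξ a p.2)).PosSemidef :=
      fun c a => Matrix.posSemidef_gram _ _
    have hs := Matrix.posSemidef_sum Finset.univ fun c _ =>
      Matrix.posSemidef_sum Finset.univ fun a _ => h c a
    convert hs using 1
    ext p q
    simp only [Matrix.of_apply, CStarMatrix.map_apply, Matrix.sum_apply, Matrix.gram_apply]
    change ∑ a, inner ℂ (ξ a p.2) ((star N * N) p.1 q.1 (ξ a q.2)) = _
    rw [Finset.sum_comm]
    refine Finset.sum_congr rfl fun a _ => ?_
    rw [CStarMatrix.mul_apply, _root_.sum_apply, inner_sum]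
    refine Finset.sum_congr rfl fun c _ => ?_
    rw [CStarMatrix.star_apply, mul_apply_eq_comp, ContinuousLinearMap.star_eq_adjoint,
      ContinuousLinearMap.adjoint_inner_right]

theorem compression_apply (ξ : Fin m → Fin n → H) (a : H →L[ℂ] H) :
    compression ξ a = gramMat ξ fun p k => a (ξ p k) := rfl

theorem compression_star (ξ : Fin m → Fin n → H) (a : H →L[ℂ] H) :
    compression ξ (star a) = star (compression ξ a) := by
  ext k l
  simp only [compression_apply, CStarMatrix.star_apply, gramMat_apply, star_sum,
    ContinuousLinearMap.star_eq_adjoint, ContinuousLinearMap.adjoint_inner_right]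
  simp

end Gram

/-! ### Compactness of unital completely positive maps -/

section Closed

variable {A : Type*} [CStarAlgebra A] [PartialOrder A] [StarOrderedRing A]

instance (n : ℕ) : FiniteDimensional ℂ (Mat n) :=
  inferInstanceAs (FiniteDimensional ℂ (Matrix (Fin n) (Fin n) ℂ))

instance (n : ℕ) : ProperSpace (Mat n) := FiniteDimensional.proper ℂ _

/-- The `n`-th level of the matrix range of a tuple `a` in a C⋆-algebra. -/
def ucpImages (n : ℕ) {d : ℕ} (a : Fin d → A) : Set (Fin d → Mat n) :=
  {X | ∃ φ : A →CP Mat n, φ 1 = 1 ∧ ∀ i, X i = φ (a i)}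

open Filter Topology in
-- Point-norm compactness of UCP maps into M_n: along an ultrafilter, maps chosen to realize the
-- tuples converge pointwise because their values stay in compact balls, and the limit is again UCP.
theorem isClosed_ucpImages (n d : ℕ) (a : Fin d → A) : IsClosed (ucpImages n a) := by
  classical
  rw [isClosed_iff_ultrafilter]
  intro X u hu hs
  set S := ucpImages n a with hS
  choose φ hφ1 hφ using fun (Y : Fin d → Mat n) (hY : Y ∈ S) => hY
  -- The value 0 off `S` is harmless, since the ultrafilter contains `S`.
  let f : (Fin d → Mat n) → A →ₗ[ℂ] Mat n := fun Y => if h : Y ∈ S then (φ Y h).toLinearMap else 0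
  have hf : ∀ Y (hY : Y ∈ S) b, f Y b = φ Y hY b := fun Y hY b => by
    simp only [f, dif_pos hY]; rfl
  have hlim : ∀ b, ∃ y, Tendsto (fun Y => f Y b) u (𝓝 y) := fun b => by
    have hc := (isCompact_closedBall (0 : Mat n) (4 * ‖b‖)).ultrafilter_le_nhds
      (u.map fun Y => f Y b) (by
        rw [le_principal_iff]
        change (fun Y => f Y b) ⁻¹' _ ∈ u
        filter_upwards [hs] with Y hY
        rw [Set.mem_preimage, mem_closedBall_zero_iff, hf Y hY]
        exact norm_map_le _ (hφ1 Y hY) b)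
    obtain ⟨y, -, hy⟩ := hc
    exact ⟨y, hy⟩
  choose g hg using hlim
  let ψ : A →CP Mat n :=
    { toFun := g
      map_add' := fun b c => tendsto_nhds_unique (hg (b + c)) (by
        simp_rw [map_add]; exact (hg b).add (hg c))
      map_smul' := fun r b => tendsto_nhds_unique (hg (r • b)) (by
        simp_rw [map_smul]; exact (hg b).const_smul r)
      map_cstarMatrix_nonneg' := fun k M hM => by
        have ht : Tendsto (fun Y => M.map (f Y)) u (𝓝 (M.map g)) :=
          tendsto_pi_nhds.mpr fun i => tendsto_pi_nhds.mpr fun j => hg (M i j)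
        refine CStarAlgebra.isClosed_nonneg.mem_of_tendsto ht ?_
        filter_upwards [hs] with Y hY
        have : M.map (f Y) = M.map (φ Y hY) := by ext i j; simp [hf Y hY]
        rw [this]
        exact (φ Y hY).map_cstarMatrix_nonneg M hM }
  refine ⟨ψ, tendsto_nhds_unique (hg 1) ?_, fun i => tendsto_nhds_unique ?_ (hg (a i))⟩
  · refine tendsto_const_nhds.congr' ?_
    filter_upwards [hs] with Y hY
    rw [hf Y hY, hφ1 Y hY]
  · have : Tendsto (fun Y : Fin d → Mat n => Y i) u (𝓝 (X i)) :=
      ((continuous_apply i).tendsto X).mono_left hu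
    refine this.congr' ?_
    filter_upwards [hs] with Y hY
    rw [hf Y hY, hφ Y hY i]

end Closed

/-! ### The truncated Poisson kernel of a row contraction -/

section RowContraction

variable {A : Type*} [CStarAlgebra A] [PartialOrder A] [StarOrderedRing A] {d : ℕ}

theorem exists_sqrt_le_one {h : A} (h0 : 0 ≤ h) (h1 : h ≤ 1) :
    ∃ c : A, 0 ≤ c ∧ c ≤ 1 ∧ star c * c = h := by
  refine ⟨CFC.sqrt h, CFC.sqrt_nonneg h, ?_, ?_⟩
  · have := CFC.sqrt_le_sqrt h 1 h1
    rwa [CFC.sqrt_one] at this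
  · rw [(IsSelfAdjoint.of_nonneg (CFC.sqrt_nonneg h)).star_eq, CFC.sqrt_mul_sqrt_self h h0]

/-- The map D ↦ ∑ T_i D T_i⋆ is positive and sends 1 below ρ, so its iterates shrink 0 ≤ D ≤ 1
geometrically. -/
theorem norm_iterate_conjugate_le {T : Fin d → A} {ρ : ℝ} (hρ : 0 ≤ ρ)
    (hT : ∑ i, T i * star (T i) ≤ (ρ : ℂ) • 1) {D : ℕ → A} (h0 : 0 ≤ D 0) (h1 : D 0 ≤ 1)
    (hD : ∀ N, D (N + 1) = ∑ i, T i * D N * star (T i)) (N : ℕ) : ‖D N‖ ≤ ρ ^ N := by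
  have key : ∀ N, 0 ≤ D N ∧ D N ≤ ((ρ ^ N : ℝ) : ℂ) • 1 := fun N => by
    induction N with
    | zero => simpa using ⟨h0, h1⟩
    | succ N ih =>
      rw [hD]
      refine ⟨Finset.sum_nonneg fun i _ => star_right_conjugate_nonneg ih.1 _, ?_⟩
      calc ∑ i, T i * D N * star (T i)
          ≤ ∑ i, T i * (((ρ ^ N : ℝ) : ℂ) • 1) * star (T i) :=
            Finset.sum_le_sum fun i _ => star_right_conjugate_le_conjugate ih.2 _
        _ = (ρ ^ N) • ∑ i, T i * star (T i) := by
            rw [Finset.smul_sum]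
            refine Finset.sum_congr rfl fun i _ => ?_
            rw [mul_smul_comm, mul_one, smul_mul_assoc, Complex.coe_smul]
        _ ≤ (ρ ^ N) • ((ρ : ℂ) • 1) := smul_le_smul_of_nonneg_left hT (pow_nonneg hρ N)
        _ = ((ρ ^ (N + 1) : ℝ) : ℂ) • 1 := by
            rw [← Complex.coe_smul, smul_smul, pow_succ, Complex.ofReal_mul]
  refine (CStarAlgebra.norm_le_norm_of_nonneg_of_le (key N).1 (key N).2).trans ?_
  rw [norm_smul, Complex.norm_real, Real.norm_of_nonneg (pow_nonneg hρ N)]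
  refine mul_le_of_le_one_right (pow_nonneg hρ N) ?_
  cases subsingleton_or_nontrivial A
  · simp [Subsingleton.elim (1 : A) 0]
  · exact CStarRing.norm_one.le

end RowContraction

section Poisson

variable {d n : ℕ} (T : Fin d → Mat n) (C : Mat n)

/-- Columns of `h ↦ Ω ⊗ C h + ∑ i, (ℓ_i ⊗ 1) V T_i⋆ h`, where `V` has the columns `ξ`. -/
def poissonStep (ξ : Fin n → Fin n → Fock d) : Fin n → Fin n → Fock d :=
  fun m k => C m k • basisVec [] + ∑ i, creation i (comp ξ (star (T i)) m k)

/-- The truncated Poisson kernels. -/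
def poisson : ℕ → Fin n → Fin n → Fock d
  | 0 => fun m k => (1 : Mat n) m k • basisVec []
  | N + 1 => poissonStep T C (poisson N)

theorem inner_creation_creation (i j : Fin d) (x y : Fock d) :
    inner ℂ (creation i x) (creation j y) = if i = j then inner ℂ x y else 0 := by
  rw [← ContinuousLinearMap.adjoint_inner_right, ← ContinuousLinearMap.star_eq_adjoint,
    ← mul_apply_eq_comp, star_creation_mul_creation]
  split_ifs <;> simp

theorem inner_vacuum_creation (i : Fin d) (x : Fock d) :
    inner ℂ (basisVec []) (creation i x) = 0 := by
  rw [← ContinuousLinearMap.adjoint_inner_left, ← ContinuousLinearMap.star_eq_adjoint,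
    star_creation_vacuum, inner_zero_left]

theorem inner_creation_vacuum (i : Fin d) (x : Fock d) :
    inner ℂ (creation i x) (basisVec []) = 0 := by
  rw [← inner_conj_symm, inner_vacuum_creation, map_zero]

theorem inner_vacuum_vacuum : inner ℂ (basisVec [] : Fock d) (basisVec []) = 1 := by
  rw [orthonormal_iff_ite.mp (orthonormal_basisVec d), if_pos rfl]

/-- The vacuum and the ranges of the ℓ_i are mutually orthogonal, so no cross terms survive. -/
theorem gramMat_poissonStep (ξ η : Fin n → Fin n → Fock d) :
    gramMat (poissonStep T C ξ) (poissonStep T C η)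
      = star C * C + ∑ i, T i * gramMat ξ η * star (T i) := by
  have h : ∀ i, T i * gramMat ξ η * star (T i)
      = gramMat (comp ξ (star (T i))) (comp η (star (T i))) := fun i => by
    rw [gramMat_comp, star_star]
  simp_rw [h]
  ext k l
  simp only [gramMat_apply, poissonStep, inner_add_left, inner_add_right, inner_smul_left,
    inner_smul_right, sum_inner, inner_sum, inner_vacuum_creation, inner_creation_vacuum,
    inner_vacuum_vacuum, inner_creation_creation, CStarMatrix.add_apply, sum_apply,
    CStarMatrix.mul_apply, CStarMatrix.star_apply,
    Finset.sum_const_zero, mul_zero, add_zero, zero_add, mul_one, Finset.sum_add_distrib,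
    starRingEnd_apply]
  rw [Finset.sum_comm]
  simp [mul_comm]

/-- Reflects ℓ_i⋆ V' = V T_i⋆, where V' is the Poisson step applied to V. -/
theorem gramMat_poissonStep_creation (ξ η : Fin n → Fin n → Fock d) (i : Fin d) :
    gramMat (poissonStep T C ξ) (fun m k => creation i (η m k)) = T i * gramMat ξ η := by
  have h : T i * gramMat ξ η = gramMat (comp ξ (star (T i))) (comp η 1) := by
    rw [gramMat_comp, star_star, mul_one]
  have h1 : comp η 1 = η := by
    funext m k
    simp [comp, CStarMatrix.one_apply]
  rw [h, h1]
  ext k l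
  simp [gramMat_apply, poissonStep, inner_vacuum_creation, inner_creation_creation]

theorem gramMat_poisson_zero : gramMat (poisson T C 0) (poisson T C 0) = 1 := by
  have : (1 : Mat n) = star 1 * 1 := by simp
  rw [this]
  ext k l
  simp only [gramMat_apply, poisson, inner_smul_left, inner_smul_right, inner_vacuum_vacuum,
    CStarMatrix.mul_apply, CStarMatrix.star_apply, mul_one, starRingEnd_apply]
  simp [mul_comm]

theorem gramMat_poisson_zero_one : gramMat (poisson T C 0) (poisson T C 1) = C := by
  have : C = star 1 * C := by simp
  conv_rhs => rw [this]
  ext k l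
  simp only [gramMat_apply, poisson, poissonStep, inner_smul_left, inner_smul_right, inner_sum,
    inner_add_right, inner_vacuum_vacuum, inner_vacuum_creation, Finset.sum_const_zero, mul_zero,
    add_zero, CStarMatrix.mul_apply, CStarMatrix.star_apply, mul_one, starRingEnd_apply]
  simp [mul_comm]

variable {T C}

theorem gramMat_poisson_self (hC : star C * C = 1 - ∑ i, T i * star (T i)) (N : ℕ) :
    gramMat (poisson T C N) (poisson T C N) = 1 := by
  induction N with
  | zero => exact gramMat_poisson_zero T C
  | succ N ih => simp [poisson, gramMat_poissonStep, ih, hC]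

theorem one_sub_gramMat_poisson_succ (hC : star C * C = 1 - ∑ i, T i * star (T i)) (N : ℕ) :
    1 - gramMat (poisson T C (N + 1)) (poisson T C (N + 1 + 1))
      = ∑ i, T i * (1 - gramMat (poisson T C N) (poisson T C (N + 1))) * star (T i) := by
  have : gramMat (poisson T C (N + 1)) (poisson T C (N + 1 + 1))
      = star C * C + ∑ i, T i * gramMat (poisson T C N) (poisson T C (N + 1)) * star (T i) :=
    gramMat_poissonStep T C _ _
  rw [this, hC]
  simp_rw [mul_sub, sub_mul, mul_one, Finset.sum_sub_distrib]
  abel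

open Filter Topology in
-- With C = (1 - ∑ T_i T_i⋆)^{1/2} the kernels V_N are isometries, and compressing ℓ_i by V_{N+1}
-- gives T_i V_N⋆V_{N+1} = T_i(1 - D_N). The defects D_N start at 1 - C and tend to 0, so closedness
-- of the range finishes.
theorem half_add_star_mem_ucpImages_of_le_smul {ρ : ℝ} (hρ : 0 ≤ ρ) (hρ1 : ρ < 1)
    (hT : ∑ i, T i * star (T i) ≤ (ρ : ℂ) • 1) :
    (fun i => (1 / 2 : ℂ) • (T i + star (T i))) ∈ ucpImages n (halfSemicircular d) := by
  have hT1 : ∑ i, T i * star (T i) ≤ 1 := hT.trans (ofReal_smul_one_le_one hρ1.le)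
  obtain ⟨C, hC0, hC1, hC⟩ := exists_sqrt_le_one (sub_nonneg.mpr hT1)
    (sub_le_self 1 (Finset.sum_nonneg fun i _ => mul_star_self_nonneg (T i)))
  set D : ℕ → Mat n := fun N => 1 - gramMat (poisson T C N) (poisson T C (N + 1)) with hD
  have hnorm : ∀ N, ‖D N‖ ≤ ρ ^ N := norm_iterate_conjugate_le hρ hT
    (by rw [hD]; simpa [gramMat_poisson_zero_one] using hC1)
    (by rw [hD]; simpa [gramMat_poisson_zero_one] using hC0)
    (one_sub_gramMat_poisson_succ hC)
  have hD0 : Tendsto D atTop (𝓝 0) := squeeze_zero_norm hnorm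
    (tendsto_pow_atTop_nhds_zero_of_lt_one hρ hρ1)
  have hφ : ∀ N i, compression (poisson T C (N + 1)) (halfSemicircular d i)
      = (1 / 2 : ℂ) • (T i * (1 - D N) + star (T i * (1 - D N))) := fun N i => by
    have : compression (poisson T C (N + 1)) (creation i) = T i * (1 - D N) := by
      rw [hD, sub_sub_cancel]
      exact gramMat_poissonStep_creation T C _ _ i
    rw [halfSemicircular, semicircular, map_smul, map_add, compression_star, this]
  refine (isClosed_ucpImages n d (halfSemicircular d)).mem_of_tendsto
    (f := fun N (i : Fin d) => (1 / 2 : ℂ) • (T i * (1 - D N) + star (T i * (1 - D N)))) (b := atTop) ?_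
    (Eventually.of_forall fun N =>
      ⟨compression (poisson T C (N + 1)), gramMat_poisson_self hC (N + 1), fun i => (hφ N i).symm⟩)
  refine tendsto_pi_nhds.mpr fun i => ?_
  have h := (tendsto_const_nhds (x := T i)).mul ((tendsto_const_nhds (x := (1 : Mat n))).sub hD0)
  rw [sub_zero, mul_one] at h
  exact (h.add h.star).const_smul (1 / 2 : ℂ)

open Filter Topology in
/-- Real parts of row contractions belong to the matrix range of the semicircular tuple. -/
theorem half_add_star_mem_ucpImages (hT : ∑ i, T i * star (T i) ≤ 1) :
    (fun i => (1 / 2 : ℂ) • (T i + star (T i))) ∈ ucpImages n (halfSemicircular d) := by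
  -- Shrink T to rT with r < 1, which makes the strict bound available with ρ = r², and let r tend
  -- to 1.
  refine (isClosed_ucpImages n d (halfSemicircular d)).mem_of_tendsto
    (f := fun (r : ℝ) (i : Fin d) => (1 / 2 : ℂ) • ((r : ℂ) • T i + star ((r : ℂ) • T i))) (b := 𝓝[<] 1)
    ?_ ?_
  · refine tendsto_pi_nhds.mpr fun i => ?_
    have h : Tendsto (fun r : ℝ => (r : ℂ) • T i) (𝓝[<] 1) (𝓝 (((1 : ℝ) : ℂ) • T i)) :=
      ((Complex.continuous_ofReal.tendsto 1).mono_left nhdsWithin_le_nhds).smul_const _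
    rw [Complex.ofReal_one, one_smul] at h
    exact (h.add h.star).const_smul (1 / 2 : ℂ)
  · filter_upwards [Ioo_mem_nhdsLT (zero_lt_one (α := ℝ))] with r hr
    refine half_add_star_mem_ucpImages_of_le_smul (T := fun i => (r : ℂ) • T i) (ρ := r ^ 2) (sq_nonneg r)
      (by nlinarith [hr.1, hr.2]) ?_
    have hr' : star (r : ℂ) = r := Complex.conj_ofReal r
    have e : ∑ i, (r : ℂ) • T i * star ((r : ℂ) • T i)
        = star ((r : ℂ) • (1 : Mat n)) * (∑ i, T i * star (T i)) * ((r : ℂ) • 1) := by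
      simp only [star_smul, hr', ← Finset.smul_sum, star_one, smul_mul_assoc,
        one_mul, mul_smul_comm, mul_one, smul_smul]
    have e' : ((r ^ 2 : ℝ) : ℂ) • (1 : Mat n)
        = star ((r : ℂ) • (1 : Mat n)) * 1 * ((r : ℂ) • 1) := by
      simp only [star_smul, hr', star_one, smul_mul_assoc, one_mul, smul_smul, sq,
        Complex.ofReal_mul]
    rw [e, e']
    exact star_left_conjugate_le_conjugate hT _

end Poisson

theorem ballB_subset_semicircularRange (d : ℕ) : ballB d ⊆ semicircularRange d := by
  intro X hX
  have hT : ∑ i, X.2 i * star (X.2 i) ≤ 1 := by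
    simpa only [(hX.1 _).star_eq, ← sq] using hX.2
  obtain ⟨φ, hφ, h⟩ := half_add_star_mem_ucpImages hT
  refine ⟨φ, hφ, fun i => ?_⟩
  refine Eq.trans ?_ (h i)
  change X.2 i = (1 / 2 : ℂ) • (X.2 i + star (X.2 i))
  rw [(hX.1 i).star_eq, ← two_smul ℂ, smul_smul]
  norm_num

/-! ### A family of pairs of `2 × 2` matrices -/

section Pair

variable {e : ℕ}

/-- The tuple `(p e₁₁, (e₁₂ + e₂₁) / 2, 0, …, 0)` of `2 × 2` matrices. -/
def pair (e : ℕ) (p : ℝ) : Fin (e + 2) → Mat 2 :=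
  Fin.cons (CStarMatrix.ofMatrix !![(p : ℂ), 0; 0, 0])
    (Fin.cons (CStarMatrix.ofMatrix !![0, 1 / 2; 1 / 2, 0]) 0)

/-- `pair e p` as an element of the noncommutative universe. -/
def pairPt (e : ℕ) (p : ℝ) : Universe (e + 2) := ⟨⟨2, two_pos⟩, pair e p⟩

theorem pair_zero (p : ℝ) : pair e p 0 = CStarMatrix.ofMatrix !![(p : ℂ), 0; 0, 0] := rfl

theorem pair_one (p : ℝ) : pair e p 1 = CStarMatrix.ofMatrix !![0, 1 / 2; 1 / 2, 0] := rfl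

theorem pair_succ_succ (p : ℝ) (i : Fin e) : pair e p i.succ.succ = 0 := rfl

theorem sum_eq_add_of_succ_succ {M : Type*} [AddCommMonoid M] (f : Fin (e + 2) → M)
    (hf : ∀ i : Fin e, f i.succ.succ = 0) : ∑ i, f i = f 0 + f 1 := by
  rw [Fin.sum_univ_succ, Fin.sum_univ_succ, Finset.sum_eq_zero fun i _ => hf i, add_zero]
  rfl

theorem forall_fin_add_two {P : Fin (e + 2) → Prop} (h0 : P 0) (h1 : P 1)
    (h : ∀ i : Fin e, P i.succ.succ) : ∀ i, P i :=
  Fin.cases h0 (Fin.cases h1 h)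

theorem isSelfAdjoint_pair (p : ℝ) : ∀ i, IsSelfAdjoint (pair e p i) := by
  refine forall_fin_add_two ?_ ?_ fun i => ?_
  · ext k l
    fin_cases k <;> fin_cases l <;>
      simp [CStarMatrix.star_apply, pair_zero, CStarMatrix.ofMatrix_apply]
  · ext k l
    fin_cases k <;> fin_cases l <;>
      simp [CStarMatrix.star_apply, pair_one, CStarMatrix.ofMatrix_apply]
  · rw [pair_succ_succ]
    exact IsSelfAdjoint.zero _

theorem pairPt_mem_saUniverse (p : ℝ) : pairPt e p ∈ saUniverse (e + 2) := isSelfAdjoint_pair p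

theorem diagonal_nonneg {a b : ℝ} (ha : 0 ≤ a) (hb : 0 ≤ b) :
    0 ≤ (CStarMatrix.ofMatrix !![(a : ℂ), 0; 0, (b : ℂ)] : Mat 2) := by
  have ha' : ((√a : ℝ) : ℂ) * ((√a : ℝ) : ℂ) = a := by
    rw [← Complex.ofReal_mul, Real.mul_self_sqrt ha]
  have hb' : ((√b : ℝ) : ℂ) * ((√b : ℝ) : ℂ) = b := by
    rw [← Complex.ofReal_mul, Real.mul_self_sqrt hb]
  have : (CStarMatrix.ofMatrix !![(a : ℂ), 0; 0, (b : ℂ)] : Mat 2)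
      = star (CStarMatrix.ofMatrix !![((√a : ℝ) : ℂ), 0; 0, ((√b : ℝ) : ℂ)] : Mat 2)
        * CStarMatrix.ofMatrix !![((√a : ℝ) : ℂ), 0; 0, ((√b : ℝ) : ℂ)] := by
    ext k l
    fin_cases k <;> fin_cases l <;>
      simp [CStarMatrix.mul_apply, Fin.sum_univ_two, CStarMatrix.star_apply,
        CStarMatrix.ofMatrix_apply, ha', hb']
  rw [this]
  exact star_mul_self_nonneg _

theorem diagonal_mul_diagonal_inv {a b a' b' : ℝ} (ha : a * a' = 1) (hb : b * b' = 1) :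
    (CStarMatrix.ofMatrix !![(a : ℂ), 0; 0, (b : ℂ)] : Mat 2)
      * CStarMatrix.ofMatrix !![(a' : ℂ), 0; 0, (b' : ℂ)] = 1 := by
  have ha' : (a : ℂ) * a' = 1 := by exact_mod_cast ha
  have hb' : (b : ℂ) * b' = 1 := by exact_mod_cast hb
  ext k l
  fin_cases k <;> fin_cases l <;>
    simp [CStarMatrix.mul_apply, Fin.sum_univ_two, CStarMatrix.ofMatrix_apply, ha', hb']

theorem pairPt_not_mem_ballB {p : ℝ} (hp : 3 / 4 < p ^ 2) : pairPt e p ∉ ballB (e + 2) := by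
  intro h
  have h2 : ∑ i, pair e p i ^ 2 ≤ 1 := h.2
  rw [sum_eq_add_of_succ_succ _ fun i => by rw [pair_succ_succ, sq, mul_zero]] at h2
  have h00 := diag_nonneg (sub_nonneg.mpr h2) 0
  simp [CStarMatrix.mul_apply, Fin.sum_univ_two, CStarMatrix.ofMatrix_apply, sq, pair_zero,
    pair_one] at h00
  have hre := (Complex.le_def.mp h00).1
  norm_num at hre
  nlinarith

theorem pairPt_one_mem_semicircularRange : pairPt e 1 ∈ semicircularRange (e + 2) := by
  -- The row (e₁₁, e₂₁) is a coisometry whose real parts are the pair with p = 1.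
  let T : Fin (e + 2) → Mat 2 := Fin.cons (CStarMatrix.ofMatrix !![1, 0; 0, 0])
    (Fin.cons (CStarMatrix.ofMatrix !![0, 0; 1, 0]) 0)
  have hT0 : T 0 = CStarMatrix.ofMatrix !![1, 0; 0, 0] := rfl
  have hT1 : T 1 = CStarMatrix.ofMatrix !![0, 0; 1, 0] := rfl
  have hT2 : ∀ i : Fin e, T i.succ.succ = 0 := fun i => rfl
  have hT : ∑ i, T i * star (T i) ≤ 1 := by
    rw [sum_eq_add_of_succ_succ _ fun i => by rw [hT2, zero_mul]]
    refine le_of_eq ?_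
    ext k l
    fin_cases k <;> fin_cases l <;>
      simp [CStarMatrix.mul_apply, Fin.sum_univ_two, CStarMatrix.star_apply, hT0, hT1,
        CStarMatrix.ofMatrix_apply]
  obtain ⟨φ, hφ, h⟩ := half_add_star_mem_ucpImages hT
  refine ⟨φ, hφ, fun i => ?_⟩
  refine Eq.trans ?_ (h i)
  change pair e 1 i = (1 / 2 : ℂ) • (T i + star (T i))
  clear h
  revert i
  refine forall_fin_add_two ?_ ?_ fun i => ?_
  · rw [pair_zero, hT0]
    ext k l
    fin_cases k <;> fin_cases l <;>
      norm_num [CStarMatrix.star_apply, CStarMatrix.ofMatrix_apply]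
  · rw [pair_one, hT1]
    ext k l
    fin_cases k <;> fin_cases l <;>
      norm_num [CStarMatrix.star_apply, CStarMatrix.ofMatrix_apply]
  · rw [pair_succ_succ, hT2]
    simp

theorem pairPt_mem_lehnerBall : pairPt e (9 / 10) ∈ lehnerBall (e + 2) := by
  refine mem_lehnerBall_of_le (pairPt_mem_saUniverse _)
    -- The lower corner requires 1/4 + b₂₂ ≤ 2, which 7/4 saturates. The upper corner is then p² +
    -- 1/7 + 1 ≤ 2, so p² ≤ 6/7 suffices, leaving room above the threshold 3/4 of the ball.
    (a := CStarMatrix.ofMatrix !![((1 : ℝ) : ℂ), 0; 0, ((4 / 7 : ℝ) : ℂ)])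
    (b := CStarMatrix.ofMatrix !![((1 : ℝ) : ℂ), 0; 0, ((7 / 4 : ℝ) : ℂ)])
    (diagonal_nonneg (by norm_num) (by norm_num))
    (IsSelfAdjoint.of_nonneg (diagonal_nonneg (by norm_num) (by norm_num))) ?_ ?_ ?_
  · exact diagonal_mul_diagonal_inv (by norm_num) (by norm_num)
  · exact diagonal_mul_diagonal_inv (by norm_num) (by norm_num)
  · set a : Mat 2 := CStarMatrix.ofMatrix !![((1 : ℝ) : ℂ), 0; 0, ((4 / 7 : ℝ) : ℂ)] with ha
    set b : Mat 2 := CStarMatrix.ofMatrix !![((1 : ℝ) : ℂ), 0; 0, ((7 / 4 : ℝ) : ℂ)] with hb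
    change ∑ i, pair e (9 / 10) i * a * pair e (9 / 10) i + b ≤ 2
    have h2 : (2 : Mat 2) = CStarMatrix.ofMatrix !![2, 0; 0, 2] := by
      rw [← one_add_one_eq_two (R := Mat 2)]
      ext k l
      rw [CStarMatrix.add_apply]
      fin_cases k <;> fin_cases l <;>
        norm_num [CStarMatrix.ofMatrix_apply, CStarMatrix.one_apply]
    rw [sum_eq_add_of_succ_succ _ fun i => by rw [pair_succ_succ, mul_zero], ← sub_nonneg, h2]
    convert diagonal_nonneg (show (0 : ℝ) ≤ 33 / 700 by norm_num) le_rfl using 1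
    ext k l
    fin_cases k <;> fin_cases l <;>
      norm_num [CStarMatrix.mul_apply, Fin.sum_univ_two, CStarMatrix.ofMatrix_apply, pair_zero,
        pair_one, ha, hb]

theorem sum_tensor_pair_le_one_iff {p q : ℝ} :
    ∑ i, tensor (pair e p i) (pair e q i) ≤ 1 ↔ p * q ≤ 15 / 16 := by
  rw [sum_eq_add_of_succ_succ _ fun i => by rw [pair_succ_succ, zero_tensor], ← sub_nonneg]
  constructor
  · intro h
    -- On the span of e₀⊗e₀ and e₁⊗e₁ the difference has rows (1 - pq, -1/4) and (-1/4, 1); `R`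
    -- tests it on the vector (1, 1/4), giving 15/16 - pq.
    let R : CStarMatrix (Fin 2) (Fin 2) (Mat 2) :=
      tensor (matUnit 0 0) (matUnit 0 0) + (1 / 4 : ℂ) • tensor (matUnit 1 0) (matUnit 1 0)
    have h00 := diag_nonneg (diag_nonneg (star_left_conjugate_nonneg h R) 0) 0
    simp [R, tensor_apply, CStarMatrix.mul_apply, Fin.sum_univ_two, CStarMatrix.star_apply,
      matUnit, CStarMatrix.ofMatrix_apply, pair_zero, pair_one, CStarMatrix.one_apply] at h00
    have hre := (Complex.le_def.mp h00).1
    norm_num at hre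
    nlinarith
  · intro h
    -- `N` completes the square in each of the two invariant planes; the remaining diagonal terms
    -- are 15/16 - pq and 15/16.
    let N : CStarMatrix (Fin 2) (Fin 2) (Mat 2) :=
      tensor (matUnit 1 1) (matUnit 1 1) - (1 / 4 : ℂ) • tensor (matUnit 1 0) (matUnit 1 0)
        + (tensor (matUnit 0 0) (matUnit 1 1) - (1 / 4 : ℂ) • tensor (matUnit 0 1) (matUnit 1 0))
    have h1 : 0 ≤ tensor (CStarMatrix.ofMatrix
        !![((15 / 16 - p * q : ℝ) : ℂ), 0; 0, ((15 / 16 : ℝ) : ℂ)] : Mat 2)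
        (matUnit 0 0 : Mat 2) :=
      tensor_nonneg (diagonal_nonneg (by linarith) (by norm_num)) (matUnit_diag_nonneg 0)
    convert add_nonneg (star_mul_self_nonneg N) h1 using 1
    ext i j k l
    fin_cases i <;> fin_cases j <;> fin_cases k <;> fin_cases l <;>
      simp [N, tensor_apply, CStarMatrix.mul_apply, Fin.sum_univ_two, CStarMatrix.star_apply,
        matUnit, CStarMatrix.ofMatrix_apply, pair_zero, pair_one] <;>
      ring

theorem pairPt_mem_ballD_iff {p : ℝ} : pairPt e p ∈ ballD (e + 2) ↔ p * p ≤ 15 / 16 := by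
  have hreal : ∀ i, (pair e p i).map (starRingEnd ℂ) = pair e p i := by
    refine forall_fin_add_two ?_ ?_ fun i => ?_
    · ext k l
      fin_cases k <;> fin_cases l <;> simp [pair_zero, CStarMatrix.ofMatrix_apply]
    · ext k l
      fin_cases k <;> fin_cases l <;> simp [pair_one, CStarMatrix.ofMatrix_apply, Complex.conj_ofNat]
    · rw [pair_succ_succ]
      ext k l
      simp
  rw [← sum_tensor_pair_le_one_iff (e := e)]
  constructor
  · rintro ⟨-, h⟩
    change ∑ i, tensor (pair e p i) ((pair e p i).map (starRingEnd ℂ)) ≤ 1 at h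
    simpa only [hreal] using h
  · intro h
    refine ⟨pairPt_mem_saUniverse p, ?_⟩
    change ∑ i, tensor (pair e p i) ((pair e p i).map (starRingEnd ℂ)) ≤ 1
    simpa only [hreal] using h

end Pair

/-! ### The inclusions and their strictness -/

theorem lehnerBall_subset_polar_ballB (d : ℕ) : lehnerBall d ⊆ polar (ballB d) := fun _ hX =>
  ⟨hX.1, fun _ hY => sum_tensor_le_one_of_mem_lehnerBall hX (ballB_subset_semicircularRange d hY)⟩

theorem semicircularRange_subset_polar_ballB (d : ℕ) :
    semicircularRange d ⊆ polar (ballB d) := fun _ hX =>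
  ⟨semicircularRange_subset_saUniverse d hX, fun _ hY =>
    sum_tensor_le_one_comm
      (sum_tensor_le_one_of_mem_lehnerBall (ballB_subset_lehnerBall d hY) hX)⟩

/-- The tuple `e_{0i} + e_{i0}` as an element of the noncommutative universe. -/
def rowColumnPt (d : ℕ) : Universe d := ⟨⟨d + 1, d.succ_pos⟩, rowColumn d⟩

theorem rowColumnPt_mem_polar_ballB (d : ℕ) : rowColumnPt d ∈ polar (ballB d) :=
  ⟨isSelfAdjoint_rowColumn, fun _ hY => sum_tensor_rowColumn_le_one hY.1 hY.2⟩

theorem mem_ballB_of_rowColumnPt_mem_lehnerBall {d : ℕ} (h : rowColumnPt d ∈ lehnerBall d)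
    {Z : Universe d} (hZ : Z ∈ semicircularRange d) : Z ∈ ballB d :=
  have hs := semicircularRange_subset_saUniverse d hZ
  ⟨hs, sum_sq_le_one_of_sum_tensor_rowColumn_le_one hs (sum_tensor_le_one_of_mem_lehnerBall h hZ)⟩

theorem mem_ballB_of_rowColumnPt_mem_semicircularRange {d : ℕ}
    (h : rowColumnPt d ∈ semicircularRange d) {Z : Universe d} (hZ : Z ∈ lehnerBall d) :
    Z ∈ ballB d :=
  ⟨hZ.1, sum_sq_le_one_of_sum_tensor_rowColumn_le_one hZ.1
    (sum_tensor_le_one_comm (sum_tensor_le_one_of_mem_lehnerBall hZ h))⟩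

end MatrixBall

theorem mainTheorem9 (d : ℕ) (hd : 2 ≤ d) :
    MatrixBall.wmin (MatrixBall.unitBall d) ⊆ MatrixBall.ballB d ∧
    MatrixBall.ballB d ⊂ MatrixBall.lehnerBall d ∧
    MatrixBall.ballB d ⊂ MatrixBall.semicircularRange d ∧
    MatrixBall.lehnerBall d ⊂ MatrixBall.polar (MatrixBall.ballB d) ∧
    MatrixBall.semicircularRange d ⊂ MatrixBall.polar (MatrixBall.ballB d) ∧
    MatrixBall.polar (MatrixBall.ballB d) ⊆ MatrixBall.wmax (MatrixBall.unitBall d) ∧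
    ¬ MatrixBall.semicircularRange d ⊆ MatrixBall.ballD d ∧
    ¬ MatrixBall.ballD d ⊆ MatrixBall.lehnerBall d ∧
    (MatrixBall.semicircularRange d ≠ MatrixBall.wmin (MatrixBall.unitBall d) ∧
      MatrixBall.semicircularRange d ≠ MatrixBall.ballB d ∧
      MatrixBall.semicircularRange d ≠ MatrixBall.ballD d ∧
      MatrixBall.semicircularRange d ≠ MatrixBall.polar (MatrixBall.ballB d) ∧
      MatrixBall.semicircularRange d ≠ MatrixBall.wmax (MatrixBall.unitBall d)) := by
  open MatrixBall in
  obtain ⟨e, rfl⟩ : ∃ e, d = e + 2 := ⟨d - 2, by omega⟩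
  have hL : pairPt e (9 / 10) ∉ ballB (e + 2) := pairPt_not_mem_ballB (by norm_num)
  have hW : pairPt e 1 ∉ ballB (e + 2) := pairPt_not_mem_ballB (by norm_num)
  have h1 : wmin (unitBall (e + 2)) ⊆ ballB (e + 2) :=
    Set.sInter_subset_of_mem (isMatrixConvexOver_ballB _)
  have h3 : ballB (e + 2) ⊂ semicircularRange (e + 2) :=
    (Set.ssubset_iff_of_subset (ballB_subset_semicircularRange _)).mpr
      ⟨_, pairPt_one_mem_semicircularRange, hW⟩
  have h5 : semicircularRange (e + 2) ⊂ polar (ballB (e + 2)) :=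
    (Set.ssubset_iff_of_subset (semicircularRange_subset_polar_ballB _)).mpr
      ⟨_, rowColumnPt_mem_polar_ballB _, fun h =>
        hL (mem_ballB_of_rowColumnPt_mem_semicircularRange h pairPt_mem_lehnerBall)⟩
  have h6 : polar (ballB (e + 2)) ⊆ wmax (unitBall (e + 2)) :=
    Set.subset_sUnion_of_mem (isMatrixConvexOver_polar_ballB _)
  have h7 : ¬ semicircularRange (e + 2) ⊆ ballD (e + 2) := fun h => by
    have := pairPt_mem_ballD_iff.mp (h (pairPt_one_mem_semicircularRange (e := e)))
    norm_num at this
  refine ⟨h1, ?_, h3, ?_, h5, h6, h7, fun h => ?_, fun h => ?_, h3.ne', fun h => h7 h.subset,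
    h5.ne, fun h => ?_⟩
  · exact (Set.ssubset_iff_of_subset (ballB_subset_lehnerBall _)).mpr
      ⟨_, pairPt_mem_lehnerBall, hL⟩
  · exact (Set.ssubset_iff_of_subset (lehnerBall_subset_polar_ballB _)).mpr
      ⟨_, rowColumnPt_mem_polar_ballB _, fun h =>
        hW (mem_ballB_of_rowColumnPt_mem_lehnerBall h pairPt_one_mem_semicircularRange)⟩
  -- Any p with 15/16 < p and p² ≤ 15/16 would do; 19/20 is such a value.
  · have hD : pairPt e (19 / 20) ∈ ballD (e + 2) := pairPt_mem_ballD_iff.mpr (by norm_num)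
    have := sum_tensor_pair_le_one_iff.mp (sum_tensor_le_one_of_mem_lehnerBall (h hD)
      pairPt_one_mem_semicircularRange)
    norm_num at this
  · exact h3.not_subset (h.subset.trans h1)
  · exact h5.not_subset (h6.trans h.symm.subset)
end
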